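/- Let $D=B(0,1)$ be the open unit ball of $\mathbb R^7$, and let $\mathcal E(u,v)=\frac12\int_D\langle\nabla u,\nabla v\rangle\,dx$, $D(\mathcal E)=H^1_0(D)$, be the classical Dirichlet form on $L^2(D;dx)$; put $\mathcal E_1(u,v)=\mathcal E(u,v)+(u,v)_{L^2(D)}$. An $\mathcal E$-nest is an increasing sequence $(F_k)$ of (relatively) closed subsets of $D$ such that $\bigcup_k\{u\in D(\mathcal E):u=0\text{ a.e. on }D\setminus F_k\}$ is $\mathcal E_1$-dense in $D(\mathcal E)$; a set is $\mathcal E$-exceptional if it is contained in $\bigcap_k(D\setminus F_k)$ for some nest; a function $f:D\to\mathbb R$ is quasi-continuous if there is a nest $(F_k)$ such that $f|_{F_k}$ is continuous for every $k$. A positive Borel measure $\mu$ on $D$ is smooth ($\mu\in S$) if it charges no exceptional Borel set and there is a nest of compact sets of finite $\mu$-measure. A measure $\mu\in S$ is of finite energy ($\mu\in S_0$) if there is $c>0$ such that $\int_D|\tilde u|\,d\mu\le c\,\mathcal E_1(u,u)^{1/2}$ for all $u\in D(\mathcal E)$, where $\tilde u$ is a quasi-continuous version of $u$. Let $\mathcal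 M_b$ be the set of signed Borel measures on $D$ of finite total variation and $\mathcal M_{0,b}=\{\mu\in\mathcal M_b:|\mu|\in S\}$. Let $\sigma_a$ be the surface measure on the sphere $\partial B(0,a)$, let $a_n=n^{-1/4}$ and let $\mu=\sum_{n\ge1}\sigma_{a_n}$, regarded as a measure on the Borel subsets of $D$ (so that the term $n=1$, which is carried by $\partial D$, contributes nothing). Then: 1. $\mu$ is a bounded smooth measure, that is, $\mu(D)<\infty$ and $\mu\in S$; hence $\mu\in\mathcal M_{0,b}$. 2. If $\mu=f\,dx+\nu$ with $f\in L^1(D;dx)$ and $\nu\in\mathcal M_b$ (in particular, if moreover $\nu\in D(\mathcal E)^*\cap\mathcal M_b$), then $\nu\notin S_0-S_0$, that is, $\nu$ is not a difference $\nu_1-\nu_2$ of two measures $\nu_1,\nu_2\in S_0$. 3. Consequently $D(\mathcal E)^*\cap\mathcal M_b$ cannot in general be replaced by $(S_0-S_0)\cap\mathcal M_b$ in the decomposition $\mathcal M_{0,b}=L^1(E;m)+D(\mathcal E)^*\cap\mathcal M_b$: for the above form, $$\mathcal M_{0,b}\neq L^1(D;dx)+(S_0-S_0)\cap\mathcal M_b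 .$$ -/

import Mathlib

open MeasureTheory Filter Topology
open scoped ContDiff Gradient

noncomputable section

/-! ### Potential theory of a bilinear form on `L²(E; m)` -/

/-- A bilinear form on `L²(E; m)`, defined on a linear subspace `domain` of `L²(E; m)`. -/
structure L2Form {E : Type*} [MeasurableSpace E] (m : Measure E) where
  /-- the domain `D(𝓔)` -/
  domain : Submodule ℝ (Lp ℝ 2 m)
  /-- the form `𝓔(u, v)`, for `u, v ∈ D(𝓔)` -/
  form : domain →ₗ[ℝ] domain →ₗ[ℝ] ℝ

namespace L2Form

section

variable {E : Type*} [TopologicalSpace E] [MeasurableSpace E] {m : Measure E}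

/-- `𝓔₁(u, v) = 𝓔(u, v) + (u, v)_{L²}`. -/
def form1 (𝓔 : L2Form m) (u v : 𝓔.domain) : ℝ :=
  𝓔.form u v + inner ℝ (u : Lp ℝ 2 m) (v : Lp ℝ 2 m)

/-- The norm `𝓔₁(u, u)^{1/2}` on `D(𝓔)`. -/
def norm1 (𝓔 : L2Form m) (u : 𝓔.domain) : ℝ := √(𝓔.form1 u u)

/-- `D(𝓔)_F`: the elements of `D(𝓔)` that vanish `m`-a.e. outside `F`. -/
def domainOn (𝓔 : L2Form m) (F : Set E) : Set 𝓔.domain :=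
  {u | ∀ᵐ x ∂m, x ∉ F → (u : Lp ℝ 2 m) x = 0}

/-- `𝓔`-nests: increasing sequences of closed sets `F k` such that `⋃ k, D(𝓔)_{F k}` is
`𝓔₁`-dense in `D(𝓔)`. -/
structure IsNest (𝓔 : L2Form m) (F : ℕ → Set E) : Prop where
  isClosed : ∀ k, IsClosed (F k)
  monotone : Monotone F
  dense : ∀ u : 𝓔.domain, ∀ ε > 0, ∃ k, ∃ v ∈ 𝓔.domainOn (F k), 𝓔.norm1 (u - v) < ε

/-- `𝓔`-exceptional sets: subsets of `⋂ k, (F k)ᶜ` for some `𝓔`-nest `F`. -/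
def IsExceptional (𝓔 : L2Form m) (N : Set E) : Prop :=
  ∃ F : ℕ → Set E, 𝓔.IsNest F ∧ N ⊆ ⋂ k, (F k)ᶜ

/-- `𝓔`-quasi-continuity: continuity on each member of some `𝓔`-nest. -/
def IsQuasiContinuous (𝓔 : L2Form m) (f : E → ℝ) : Prop :=
  ∃ F : ℕ → Set E, 𝓔.IsNest F ∧ ∀ k, ContinuousOn f (F k)

/-- `f` is an `𝓔`-quasi-continuous `m`-version of `u ∈ D(𝓔)`. -/
def IsQCVersion (𝓔 : L2Form m) (u : 𝓔.domain) (f : E → ℝ) : Prop :=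
  𝓔.IsQuasiContinuous f ∧ f =ᵐ[m] ((u : Lp ℝ 2 m) : E → ℝ)

/-- The class `S` of `𝓔`-smooth (positive Borel) measures. -/
structure IsSmooth (𝓔 : L2Form m) (μ : Measure E) : Prop where
  null_of_exceptional : ∀ B, MeasurableSet B → 𝓔.IsExceptional B → μ B = 0
  exists_nest : ∃ F : ℕ → Set E, 𝓔.IsNest F ∧ ∀ k, IsCompact (F k) ∧ μ (F k) < ⊤

/-- The class `S₀` of smooth measures of finite energy integral: `μ ∈ S` and there is `c > 0` with
`∫ |ũ| dμ ≤ c 𝓔₁(u, u)^{1/2}` for all `u ∈ D(𝓔)`, where `ũ` is a quasi-continuous version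
of `u`. -/
def FiniteEnergy (𝓔 : L2Form m) (μ : Measure E) : Prop :=
  𝓔.IsSmooth μ ∧ ∃ c : ℝ, 0 < c ∧ ∀ (u : 𝓔.domain) (f : E → ℝ), 𝓔.IsQCVersion u f →
    ∫⁻ x, ‖f x‖ₑ ∂μ ≤ ENNReal.ofReal (c * 𝓔.norm1 u)

/-- `𝓜_{0,b}`: the bounded signed Borel measures whose total variation is smooth. -/
def boundedSmooth (𝓔 : L2Form m) : Set (SignedMeasure E) :=
  {μ | 𝓔.IsSmooth μ.totalVariation}

/-- `(S₀ - S₀) ∩ 𝓜_b`: the bounded signed Borel measures `ν` of the form `ν₁ - ν₂` with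
`ν₁, ν₂ ∈ S₀`. As `ν₁` and `ν₂` may be infinite, the equality `ν⁺ - ν⁻ = ν₁ - ν₂` is expressed
as `ν⁺ + ν₂ = ν⁻ + ν₁`. -/
def finiteEnergyDiff (𝓔 : L2Form m) : Set (SignedMeasure E) :=
  {ν | ∃ ν₁ ν₂ : Measure E, 𝓔.FiniteEnergy ν₁ ∧ 𝓔.FiniteEnergy ν₂ ∧
    ν.toJordanDecomposition.posPart + ν₂ = ν.toJordanDecomposition.negPart + ν₁}

end

end L2Form

/-! ### The space `H¹₀(D)` and the classical Dirichlet form -/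

section Sobolev

variable {d : ℕ}

/-- Lebesgue measure on the subset `D` of `ℝᵈ`, as a measure on the type `D`. -/
def lebesgueOn (D : Set (EuclideanSpace ℝ (Fin d))) : Measure D :=
  (volume : Measure (EuclideanSpace ℝ (Fin d))).comap Subtype.val

theorem lebesgueOn_measurePreserving {D : Set (EuclideanSpace ℝ (Fin d))}
    (hD : MeasurableSet D) :
    MeasurePreserving Subtype.val (lebesgueOn D) (volume.restrict D) :=
  measurePreserving_subtype_coe hD

/-- Test functions on `D`: smooth functions with compact support contained in `D`. -/
def IsTestFunction (D : Set (EuclideanSpace ℝ (Fin d)))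
    (φ : EuclideanSpace ℝ (Fin d) → ℝ) : Prop :=
  ContDiff ℝ ∞ φ ∧ HasCompactSupport φ ∧ tsupport φ ⊆ D

/-- `g` is a weak gradient of `u` on `D`. -/
def IsWeakGradient (D : Set (EuclideanSpace ℝ (Fin d)))
    (u : D → ℝ) (g : D → EuclideanSpace ℝ (Fin d)) : Prop :=
  ∀ φ, IsTestFunction D φ → ∫ x : D, u x • ∇ φ (x : EuclideanSpace ℝ (Fin d)) ∂(lebesgueOn D) =
    -∫ x : D, φ (x : EuclideanSpace ℝ (Fin d)) • g x ∂(lebesgueOn D)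

/-- `(u, g)` is an `L²(D) × L²(D; ℝᵈ)`-limit of pairs `(φₙ, ∇φₙ)` with test functions `φₙ`. -/
def IsTestLimit (D : Set (EuclideanSpace ℝ (Fin d)))
    (u : D → ℝ) (g : D → EuclideanSpace ℝ (Fin d)) : Prop :=
  ∃ φ : ℕ → EuclideanSpace ℝ (Fin d) → ℝ, (∀ n, IsTestFunction D (φ n)) ∧
    Tendsto (fun n => eLpNorm (fun x : D => u x - φ n x) 2 (lebesgueOn D)) atTop (𝓝 0) ∧
    Tendsto (fun n => eLpNorm (fun x : D => g x - ∇ (φ n) (x : EuclideanSpace ℝ (Fin d))) 2 (lebesgueOn D))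
      atTop (𝓝 0)

namespace IsTestFunction

variable {D : Set (EuclideanSpace ℝ (Fin d))}
  {φ ψ : EuclideanSpace ℝ (Fin d) → ℝ}

theorem differentiable (hφ : IsTestFunction D φ) : Differentiable ℝ φ :=
  hφ.1.differentiable (by simp)

theorem zero : IsTestFunction D (0 : EuclideanSpace ℝ (Fin d) → ℝ) :=
  ⟨contDiff_const, HasCompactSupport.zero, by simp⟩

theorem add (hφ : IsTestFunction D φ) (hψ : IsTestFunction D ψ) : IsTestFunction D (φ + ψ) :=
  ⟨hφ.1.add hψ.1, hφ.2.1.add hψ.2.1,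
    (tsupport_add φ ψ).trans (Set.union_subset hφ.2.2 hψ.2.2)⟩

theorem const_smul (c : ℝ) (hφ : IsTestFunction D φ) : IsTestFunction D (c • φ) :=
  ⟨contDiff_const.smul hφ.1, hφ.2.1.smul_left (f := fun _ => c),
    (tsupport_smul_subset_right (fun _ => c) φ).trans hφ.2.2⟩

theorem gradient_add (hφ : IsTestFunction D φ) (hψ : IsTestFunction D ψ)
    (x : EuclideanSpace ℝ (Fin d)) : ∇ (φ + ψ) x = ∇ φ x + ∇ ψ x := by
  simp [gradient, fderiv_add (hφ.differentiable x) (hψ.differentiable x)]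

theorem gradient_const_smul (c : ℝ) (hφ : IsTestFunction D φ)
    (x : EuclideanSpace ℝ (Fin d)) : ∇ (c • φ) x = c • ∇ φ x := by
  simp [gradient, fderiv_const_smul (hφ.differentiable x)]

theorem memLp (hD : IsOpen D) (hφ : IsTestFunction D φ) :
    MemLp (fun x : D => φ (x : EuclideanSpace ℝ (Fin d))) 2 (lebesgueOn D) :=
  ((hφ.1.continuous.memLp_of_hasCompactSupport (p := 2) (μ := volume) hφ.2.1).restrict
    D).comp_measurePreserving
    (lebesgueOn_measurePreserving hD.measurableSet)

theorem memLp_gradient (hD : IsOpen D) (hφ : IsTestFunction D φ) :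
    MemLp (fun x : D => ∇ φ (x : EuclideanSpace ℝ (Fin d))) 2 (lebesgueOn D) := by
  have hc : Continuous (∇ φ) :=
    (InnerProductSpace.toDual ℝ (EuclideanSpace ℝ (Fin d))).symm.continuous.comp
      (hφ.1.continuous_fderiv (by simp))
  have hs : HasCompactSupport (∇ φ) :=
    (hφ.2.1.fderiv ℝ).comp_left (g := (InnerProductSpace.toDual ℝ _).symm) (map_zero _)
  exact ((hc.memLp_of_hasCompactSupport (p := 2) (μ := volume) hs).restrict
    D).comp_measurePreserving
    (lebesgueOn_measurePreserving hD.measurableSet)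

end IsTestFunction

variable (D : Set (EuclideanSpace ℝ (Fin d))) (hD : IsOpen D)

/-- The graph of the weak gradient on `H¹₀(D)`: the pairs `(u, ∇u)` where `u` belongs to the closure
of the test functions in `H¹(D)`. -/
def gradGraph : Submodule ℝ
    (Lp ℝ 2 (lebesgueOn D) × Lp (EuclideanSpace ℝ (Fin d)) 2 (lebesgueOn D)) where
  carrier := {p | IsWeakGradient D p.1 p.2 ∧ IsTestLimit D p.1 p.2}
  zero_mem' := by
    have h1 := Lp.coeFn_zero ℝ 2 (lebesgueOn D)
    have h2 := Lp.coeFn_zero (EuclideanSpace ℝ (Fin d)) 2 (lebesgueOn D)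
    refine ⟨fun φ _ => ?_, fun _ => 0, fun _ => IsTestFunction.zero, ?_, ?_⟩
    · rw [integral_eq_zero_of_ae, integral_eq_zero_of_ae, neg_zero]
      · filter_upwards [h2] with x hx
        exact (congrArg (φ x • ·) hx).trans (smul_zero _)
      · filter_upwards [h1] with x hx
        exact (congrArg (· • ∇ φ x.1) hx).trans (zero_smul _ _)
    · refine tendsto_const_nhds.congr fun n => ?_
      rw [eq_comm, eLpNorm_congr_ae (g := 0), eLpNorm_zero]
      filter_upwards [h1] with x hx
      exact (congrArg (· - (0 : ℝ)) hx).trans (sub_zero _)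
    · refine tendsto_const_nhds.congr fun n => ?_
      rw [eq_comm, eLpNorm_congr_ae (g := 0), eLpNorm_zero]
      filter_upwards [h2] with x hx
      refine (congrArg (· - ∇ (fun _ => (0 : ℝ)) x.1) hx).trans ?_
      simp [gradient]
  add_mem' := by
    rintro ⟨u, g⟩ ⟨v, k⟩ ⟨hu, φ, hφ, hφ1, hφ2⟩ ⟨hv, ψ, hψ, hψ1, hψ2⟩
    have h1 := Lp.coeFn_add u v
    have h2 := Lp.coeFn_add g k
    refine ⟨fun η hη => ?_, fun n => φ n + ψ n, fun n => (hφ n).add (hψ n), ?_, ?_⟩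
    · have e1 : ∫ x : D, (u + v) x • ∇ η (x : EuclideanSpace ℝ (Fin d)) ∂(lebesgueOn D) =
          ∫ x : D, (u x • ∇ η (x : EuclideanSpace ℝ (Fin d)) +
            v x • ∇ η (x : EuclideanSpace ℝ (Fin d))) ∂(lebesgueOn D) := by
        refine integral_congr_ae ?_
        filter_upwards [h1] with x hx
        rw [hx, Pi.add_apply, add_smul]
      have e2 : ∫ x : D, η (x : EuclideanSpace ℝ (Fin d)) • (g + k) x ∂(lebesgueOn D) =
          ∫ x : D, (η (x : EuclideanSpace ℝ (Fin d)) • g x +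
            η (x : EuclideanSpace ℝ (Fin d)) • k x) ∂(lebesgueOn D) := by
        refine integral_congr_ae ?_
        filter_upwards [h2] with x hx
        rw [hx, Pi.add_apply, smul_add]
      change ∫ x : D, (u + v) x • ∇ η (x : EuclideanSpace ℝ (Fin d)) ∂(lebesgueOn D) =
        -∫ x : D, η (x : EuclideanSpace ℝ (Fin d)) • (g + k) x ∂(lebesgueOn D)
      rw [e1, e2, integral_add, integral_add, hu η hη, hv η hη, neg_add]
      · exact memLp_one_iff_integrable.1 ((Lp.memLp g).smul (hη.memLp hD))
      · exact memLp_one_iff_integrable.1 ((Lp.memLp k).smul (hη.memLp hD))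
      · exact memLp_one_iff_integrable.1 ((hη.memLp_gradient hD).smul (Lp.memLp u))
      · exact memLp_one_iff_integrable.1 ((hη.memLp_gradient hD).smul (Lp.memLp v))
    · refine tendsto_of_tendsto_of_tendsto_of_le_of_le tendsto_const_nhds
        (by simpa using hφ1.add hψ1) (fun _ => zero_le) fun n => ?_
      refine le_trans (eLpNorm_congr_ae ?_).le (eLpNorm_add_le
        ((Lp.aestronglyMeasurable u).sub ((hφ n).memLp hD).1)
        ((Lp.aestronglyMeasurable v).sub ((hψ n).memLp hD).1) (by norm_num))
      filter_upwards [h1] with x hx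
      refine (congrArg (· - (φ n + ψ n) x.1) hx).trans ?_
      simp only [Pi.add_apply]
      ring
    · refine tendsto_of_tendsto_of_tendsto_of_le_of_le tendsto_const_nhds
        (by simpa using hφ2.add hψ2) (fun _ => zero_le) fun n => ?_
      refine le_trans (eLpNorm_congr_ae ?_).le (eLpNorm_add_le
        ((Lp.aestronglyMeasurable g).sub ((hφ n).memLp_gradient hD).1)
        ((Lp.aestronglyMeasurable k).sub ((hψ n).memLp_gradient hD).1) (by norm_num))
      filter_upwards [h2] with x hx
      refine (congrArg (· - ∇ (φ n + ψ n) x.1) hx).trans ?_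
      simp only [(hφ n).gradient_add (hψ n), Pi.add_apply]
      abel
  smul_mem' := by
    rintro c ⟨u, g⟩ ⟨hu, φ, hφ, hφ1, hφ2⟩
    have h1 := Lp.coeFn_smul c u
    have h2 := Lp.coeFn_smul c g
    refine ⟨fun η hη => ?_, fun n => c • φ n, fun n => (hφ n).const_smul c, ?_, ?_⟩
    · have e1 : ∫ x : D, (c • u) x • ∇ η (x : EuclideanSpace ℝ (Fin d)) ∂(lebesgueOn D) =
          ∫ x : D, c • (u x • ∇ η (x : EuclideanSpace ℝ (Fin d))) ∂(lebesgueOn D) := by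
        refine integral_congr_ae ?_
        filter_upwards [h1] with x hx
        simp [hx, mul_smul]
      have e2 : ∫ x : D, η (x : EuclideanSpace ℝ (Fin d)) • (c • g) x ∂(lebesgueOn D) =
          ∫ x : D, c • (η (x : EuclideanSpace ℝ (Fin d)) • g x) ∂(lebesgueOn D) := by
        refine integral_congr_ae ?_
        filter_upwards [h2] with x hx
        simp [hx, smul_comm c]
      change ∫ x : D, (c • u) x • ∇ η (x : EuclideanSpace ℝ (Fin d)) ∂(lebesgueOn D) =
        -∫ x : D, η (x : EuclideanSpace ℝ (Fin d)) • (c • g) x ∂(lebesgueOn D)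
      rw [e1, e2, integral_smul, integral_smul, hu η hη, smul_neg]
    · have := ENNReal.Tendsto.const_mul (a := ‖c‖ₑ) hφ1 (Or.inr enorm_ne_top)
      rw [mul_zero] at this
      refine this.congr fun n => ?_
      rw [← eLpNorm_const_smul]
      refine eLpNorm_congr_ae ?_
      filter_upwards [h1] with x hx
      simp [hx, mul_sub]
    · have := ENNReal.Tendsto.const_mul (a := ‖c‖ₑ) hφ2 (Or.inr enorm_ne_top)
      rw [mul_zero] at this
      refine this.congr fun n => ?_
      rw [← eLpNorm_const_smul]
      refine eLpNorm_congr_ae ?_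
      filter_upwards [h2] with x hx
      simp [hx, (hφ n).gradient_const_smul c, smul_sub]

/-- Weak gradients are unique, so `gradGraph D hD` is the graph of a linear operator. -/
theorem gradGraph_snd_eq_zero :
    ∀ p ∈ gradGraph D hD, p.1 = 0 → p.2 = 0 := by
  rintro ⟨u, g⟩ ⟨hu, -⟩ (rfl : u = 0)
  have h0 := Lp.coeFn_zero ℝ 2 (lebesgueOn D)
  have hDm := hD.measurableSet
  have hemb := MeasurableEmbedding.subtype_coe hDm
  have hmap : Measure.map ((↑) : D → EuclideanSpace ℝ (Fin d)) (lebesgueOn D) =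
      volume.restrict D :=
    (lebesgueOn_measurePreserving hDm).map_eq
  set G : EuclideanSpace ℝ (Fin d) → EuclideanSpace ℝ (Fin d) :=
    Function.extend ((↑) : D → EuclideanSpace ℝ (Fin d)) g 0 with hG
  have hGg : ∀ x : D, G x = g x := fun x => Subtype.val_injective.extend_apply _ _ x
  have hGL : MemLp G 2 (volume.restrict D) := by
    rw [← hmap, hemb.memLp_map_measure_iff]
    exact (memLp_congr_ae (Eventually.of_forall hGg)).2 (Lp.memLp g)
  have key := hD.ae_eq_zero_of_integral_contDiff_smul_eq_zero (μ := volume) (f := G)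
    (locallyIntegrableOn_of_locallyIntegrable_restrict (hGL.locallyIntegrable (by norm_num)))
    (fun φ h1 h2 h3 => by
      have h4 := hu φ ⟨h1, h2, h3⟩
      rw [integral_eq_zero_of_ae (by
        filter_upwards [h0] with x hx
        exact (congrArg (· • ∇ φ x.1) hx).trans (zero_smul _ _)), eq_comm,
        neg_eq_zero] at h4
      have h5 : ∫ x in D, φ x • G x = ∫ x, φ x • G x := by
        refine setIntegral_eq_integral_of_forall_compl_eq_zero fun x hx => ?_
        rw [image_eq_zero_of_notMem_tsupport fun h => hx (h3 h), zero_smul]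
      rw [← h5, ← hmap, hemb.integral_map, ← h4]
      simp only [hGg])
  refine Lp.ext ?_
  have key' : ∀ᵐ x ∂(volume.restrict D), G x = 0 :=
    (ae_restrict_iff' hDm).2 key
  rw [← hmap, hemb.ae_map_iff] at key'
  filter_upwards [key', Lp.coeFn_zero (EuclideanSpace ℝ (Fin d)) 2 (lebesgueOn D)]
    with x hx hx'
  rw [hx', ← hGg, hx]
  rfl

/-- The weak gradient `∇` as a linear operator from `L²(D)` to `L²(D; ℝᵈ)` with
domain `H¹₀(D)`. -/
def weakGrad :
    Lp ℝ 2 (lebesgueOn D) →ₗ.[ℝ] Lp (EuclideanSpace ℝ (Fin d)) 2 (lebesgueOn D) :=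
  (gradGraph D hD).toLinearPMap

theorem weakGrad_graph : (weakGrad D hD).graph = gradGraph D hD :=
  Submodule.toLinearPMap_graph_eq _ fun p hp h => gradGraph_snd_eq_zero D hD p hp h

/-- The classical Dirichlet form `𝓔(u, v) = ½ ∫_D ⟨∇u, ∇v⟩ dx`, with domain `H¹₀(D)`. -/
def classicalForm : L2Form (lebesgueOn D) where
  domain := (weakGrad D hD).domain
  form := (1 / 2 : ℝ) • (innerₗ (Lp (EuclideanSpace ℝ (Fin d)) 2 (lebesgueOn D))).compl₁₂
    (weakGrad D hD).toFun (weakGrad D hD).toFun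

theorem classicalForm_form_apply (u v : (classicalForm D hD).domain) :
    (classicalForm D hD).form u v =
      (1 / 2) * ∫ x : D, inner ℝ (weakGrad D hD u x) (weakGrad D hD v x) ∂(lebesgueOn D) := by
  rw [← L2.inner_def]
  rfl

end Sobolev

/-! ### The measure -/

/-- The open unit ball of `ℝ⁷`. -/
def unitBall7 : Set (EuclideanSpace ℝ (Fin 7)) := Metric.ball 0 1

theorem isOpen_unitBall7 : IsOpen unitBall7 := Metric.isOpen_ball

/-- The surface measure `σ_a` on the sphere `∂B(0, a)` in `ℝᵈ`, for `a > 0`: the image of the surface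
measure of the unit sphere under `x ↦ a x`, multiplied by `a ^ (d - 1)`. -/
def surfaceMeasure (d : ℕ) (a : ℝ) : Measure (EuclideanSpace ℝ (Fin d)) :=
  ENNReal.ofReal (a ^ (d - 1)) •
    (volume : Measure (EuclideanSpace ℝ (Fin d))).toSphere.map
      (fun x : Metric.sphere (0 : EuclideanSpace ℝ (Fin d)) 1 => a • x.1)

/-- The measure `μ = ∑_{n ≥ 1} σ_{a_n}` on the open unit ball `D` of `ℝ⁷`, with `a_n = n ^ (-1/4)`.
The summand with index `n : ℕ` is `σ_{a_{n+1}}`, regarded as a measure on `D` (that is, evaluated on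
Borel subsets of `D`). -/
def sphereSum : Measure unitBall7 :=
  Measure.sum fun n : ℕ =>
    (surfaceMeasure 7 (((n : ℝ) + 1) ^ (-(1 / 4) : ℝ))).comap Subtype.val

end

/-!
# The decomposition of bounded smooth measures fails with `S₀ - S₀`

Let `μ` be the sum of the surface measures of the spheres of radius `a_n = n ^ (-1/4)` in the unit
ball `D` of `ℝ⁷`. It is finite, since `σ_{a_n}` has mass of order `a_n ^ 6 = n ^ (-3/2)`.

*Smoothness.* Compact exhaustions of `D` are nests, because test functions are dense in `H¹₀(D)`, so
only exceptional sets matter. They are handled without capacities and traces. Writing a test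
function as the integral of its radial derivative along the outer part of each ray gives
`∫_{a < |x| < b} |φ| ≤ (b - a) ∫ |∇φ|` (`lintegral_shell_le_lintegral_fderiv`), and this estimate
passes to `H¹₀(D)` (`lintegral_shell_le_weakGrad`). Let `(F_k)` be a nest, and `η` a cutoff function
that is `1` near the sphere of radius `a`. Some `v ∈ H¹₀(D)` vanishing off some `F_k` is close to
`η`; as `|η - v| = 1` on the part of thin shells outside `F_k`, the volume of that part is at most a
small constant times the thickness of the shell. Since `D \ F_k` is open, letting the thickness tend
to `0` shows that its area on the sphere is small as well (`ofReal_pow_mul_toSphere_le`,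
`surfaceMeasure_compl_le`). Hence surface measures charge no exceptional set.

*Infinite energy.* Suppose that `μ = f dx + ν` and `ν = ν₁ - ν₂` with `ν₁, ν₂ ∈ S₀`. The union of
the spheres is Lebesgue null, so on it `μ = ν`, and therefore `μ ≤ ν₁`
(`le_of_toSignedMeasure_eq_withDensityᵥ_add`). So `μ` satisfies the energy estimate of `ν₁`. Test it
with cutoffs of `(|x|² + ε)⁻¹`. They are bounded in `H¹`, because `|x|⁻³` is square integrable near
the origin of `ℝ⁷` (`exists_test_inv_norm_sq_add_bound`), whereas their `μ`-integrals are
unbounded as `ε → 0`, because `∑ a_n ^ 6 / a_n ^ 2 = ∑ 1 / n` diverges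
(`not_exists_energy_bound_sphereSum`).
-/

/-! ### Test functions as elements of `H¹₀(D)` -/

section TestFunctions

variable {d : ℕ} {D : Set (EuclideanSpace ℝ (Fin d))}

namespace IsTestFunction

variable {φ : EuclideanSpace ℝ (Fin d) → ℝ}

theorem continuous_gradient (hφ : IsTestFunction D φ) : Continuous (∇ φ) :=
  (InnerProductSpace.toDual ℝ (EuclideanSpace ℝ (Fin d))).symm.continuous.comp
    (hφ.1.continuous_fderiv (by simp))

theorem eq_zero_of_notMem (hφ : IsTestFunction D φ) {x : EuclideanSpace ℝ (Fin d)} (hx : x ∉ D) :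
    φ x = 0 :=
  image_eq_zero_of_notMem_tsupport fun h => hx (hφ.2.2 h)

theorem gradient_eq_zero_of_notMem (hφ : IsTestFunction D φ) {x : EuclideanSpace ℝ (Fin d)}
    (hx : x ∉ D) : ∇ φ x = 0 := by
  have : fderiv ℝ φ x = 0 :=
    image_eq_zero_of_notMem_tsupport fun h => hx (hφ.2.2 (tsupport_fderiv_subset ℝ h))
  simp [gradient, this]

theorem isWeakGradient (hD : IsOpen D) (hφ : IsTestFunction D φ) :
    IsWeakGradient D (fun x => φ x) (fun x => ∇ φ x) := by
  intro ψ hψ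
  have key : ∀ χ θ : EuclideanSpace ℝ (Fin d) → ℝ, IsTestFunction D χ →
      ∫ x : D, χ x • ∇ θ (x : EuclideanSpace ℝ (Fin d)) ∂(lebesgueOn D) =
        ∫ x, χ x • ∇ θ x := by
    intro χ θ hχ
    rw [lebesgueOn, integral_subtype_comap hD.measurableSet fun x => χ x • ∇ θ x]
    refine setIntegral_eq_integral_of_forall_compl_eq_zero fun x hx => ?_
    rw [hχ.eq_zero_of_notMem hx, zero_smul]
  have hint : ∀ χ θ : EuclideanSpace ℝ (Fin d) → ℝ, IsTestFunction D χ → IsTestFunction D θ →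
      Integrable (fun x => χ x • ∇ θ x) := fun χ θ hχ hθ =>
    (hχ.1.continuous.smul hθ.continuous_gradient).integrable_of_hasCompactSupport
      hχ.2.1.smul_right
  have hinner : ∀ (θ : EuclideanSpace ℝ (Fin d) → ℝ) (x v : EuclideanSpace ℝ (Fin d)),
      inner ℝ v (∇ θ x) = fderiv ℝ θ x v := fun θ x v => by
    rw [real_inner_comm, gradient, InnerProductSpace.toDual_symm_apply]
  rw [key φ ψ hφ, key ψ φ hψ]
  refine ext_inner_left ℝ fun v => ?_
  rw [inner_neg_right, ← integral_inner (hint _ _ hφ hψ), ← integral_inner (hint _ _ hψ hφ)]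
  simp only [inner_smul_right, hinner]
  have hI : ∀ χ θ : EuclideanSpace ℝ (Fin d) → ℝ, IsTestFunction D χ → IsTestFunction D θ →
      Integrable (fun x => χ x * fderiv ℝ θ x v) := fun χ θ hχ hθ => by
    simpa only [inner_smul_right, hinner] using
      (hint χ θ hχ hθ).const_inner (𝕜 := ℝ) v
  rw [integral_mul_fderiv_eq_neg_fderiv_mul_of_integrable
    ((hI ψ φ hψ hφ).congr (.of_forall fun x => mul_comm _ _)) (hI φ ψ hφ hψ)
    ((hφ.1.continuous.mul hψ.1.continuous).integrable_of_hasCompactSupport hφ.2.1.mul_right)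
    (fun x _ => hφ.differentiable x) (fun x _ => hψ.differentiable x)]
  simp only [mul_comm]

/-- Test functions belong to `H¹₀(D)`, and their weak gradient is the classical one. -/
theorem exists_mem_domain (hD : IsOpen D) (hφ : IsTestFunction D φ) :
    ∃ u : (classicalForm D hD).domain,
      ((u : Lp ℝ 2 (lebesgueOn D)) =ᵐ[lebesgueOn D] fun x => φ x) ∧
      (weakGrad D hD u =ᵐ[lebesgueOn D] fun x => ∇ φ x) := by
  have h1 := (hφ.memLp hD).coeFn_toLp
  have h2 := (hφ.memLp_gradient hD).coeFn_toLp
  have hmem : ((hφ.memLp hD).toLp, (hφ.memLp_gradient hD).toLp) ∈ (weakGrad D hD).graph := by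
    rw [weakGrad_graph]
    refine ⟨fun ψ hψ => ?_, fun _ => φ, fun _ => hφ, ?_, ?_⟩
    · refine Eq.trans (integral_congr_ae ?_)
        ((hφ.isWeakGradient hD ψ hψ).trans (congrArg _ (integral_congr_ae ?_)))
      · filter_upwards [h1] with x hx
        exact congrArg (· • ∇ ψ (x : EuclideanSpace ℝ (Fin d))) hx
      · filter_upwards [h2] with x hx
        exact congrArg (ψ x • ·) hx.symm
    · refine tendsto_const_nhds.congr fun n => ?_
      rw [eq_comm, eLpNorm_congr_ae (g := 0), eLpNorm_zero]
      filter_upwards [h1] with x hx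
      exact sub_eq_zero.2 hx
    · refine tendsto_const_nhds.congr fun n => ?_
      rw [eq_comm, eLpNorm_congr_ae (g := 0), eLpNorm_zero]
      filter_upwards [h2] with x hx
      exact sub_eq_zero.2 hx
  obtain ⟨u, hu, hgu⟩ := (LinearPMap.mem_graph_iff _).1 hmem
  refine ⟨u, ?_, ?_⟩
  · rw [hu]; exact h1
  · rw [hgu]; exact h2

end IsTestFunction

/-! ### The norm of `H¹₀(D)` -/

section Norm

variable (hD : IsOpen D)

theorem classicalForm_form1_self (u : (classicalForm D hD).domain) :
    (classicalForm D hD).form1 u u =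
      1 / 2 * ‖weakGrad D hD u‖ ^ 2 + ‖(u : Lp ℝ 2 (lebesgueOn D))‖ ^ 2 := by
  rw [L2Form.form1, real_inner_self_eq_norm_sq, classicalForm_form_apply, ← L2.inner_def,
    real_inner_self_eq_norm_sq]

theorem classicalForm_norm1_le (u : (classicalForm D hD).domain) :
    (classicalForm D hD).norm1 u ≤ ‖weakGrad D hD u‖ + ‖(u : Lp ℝ 2 (lebesgueOn D))‖ := by
  rw [L2Form.norm1, classicalForm_form1_self]
  refine Real.sqrt_le_iff.2 ⟨by positivity, ?_⟩
  have := norm_nonneg (weakGrad D hD u)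
  have := norm_nonneg (u : Lp ℝ 2 (lebesgueOn D))
  nlinarith [mul_nonneg (norm_nonneg (weakGrad D hD u)) (norm_nonneg (u : Lp ℝ 2 (lebesgueOn D)))]

theorem norm_weakGrad_le (u : (classicalForm D hD).domain) :
    ‖weakGrad D hD u‖ ≤ 2 * (classicalForm D hD).norm1 u := by
  rw [L2Form.norm1, classicalForm_form1_self, ← Real.sqrt_sq (norm_nonneg (weakGrad D hD u)),
    show (2 : ℝ) = √(2 ^ 2) by simp, ← Real.sqrt_mul (by positivity)]
  refine Real.sqrt_le_sqrt ?_
  nlinarith [sq_nonneg ‖weakGrad D hD u‖, sq_nonneg ‖(u : Lp ℝ 2 (lebesgueOn D))‖,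
    Real.sq_sqrt (sq_nonneg ‖weakGrad D hD u‖)]

theorem isTestLimit_weakGrad (u : (classicalForm D hD).domain) :
    IsTestLimit D (u : Lp ℝ 2 (lebesgueOn D)) (weakGrad D hD u) := by
  have h : ((u : Lp ℝ 2 (lebesgueOn D)), weakGrad D hD u) ∈ (weakGrad D hD).graph :=
    (weakGrad D hD).mem_graph u
  rw [weakGrad_graph] at h
  exact h.2

/-- Test functions are `𝓔₁`-dense in `H¹₀(D)`. -/
theorem exists_test_norm1_sub_lt (u : (classicalForm D hD).domain) {ε : ℝ} (hε : 0 < ε) :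
    ∃ φ, IsTestFunction D φ ∧ ∃ v : (classicalForm D hD).domain,
      ((v : Lp ℝ 2 (lebesgueOn D)) =ᵐ[lebesgueOn D] fun x => φ x) ∧
      (classicalForm D hD).norm1 (u - v) < ε := by
  obtain ⟨φ, hφ, h1, h2⟩ := isTestLimit_weakGrad hD u
  have hpos : (0 : ENNReal) < ENNReal.ofReal (ε / 2) := ENNReal.ofReal_pos.2 (by linarith)
  obtain ⟨n, hn1, hn2⟩ := ((h1.eventually_lt_const hpos).and (h2.eventually_lt_const hpos)).exists
  obtain ⟨v, hv1, hv2⟩ := (hφ n).exists_mem_domain hD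
  refine ⟨φ n, hφ n, v, hv1, (classicalForm_norm1_le hD _).trans_lt ?_⟩
  have e1 : ‖((u - v : (classicalForm D hD).domain) : Lp ℝ 2 (lebesgueOn D))‖ < ε / 2 := by
    rw [Lp.norm_def]
    refine (ENNReal.lt_ofReal_iff_toReal_lt (Lp.eLpNorm_ne_top _)).1 (lt_of_eq_of_lt ?_ hn1)
    refine eLpNorm_congr_ae ?_
    filter_upwards [hv1, Lp.coeFn_sub (u : Lp ℝ 2 (lebesgueOn D)) v] with x hx hx'
    rw [Submodule.coe_sub, hx', Pi.sub_apply, hx]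
  have e2 : ‖weakGrad D hD (u - v)‖ < ε / 2 := by
    rw [Lp.norm_def]
    refine (ENNReal.lt_ofReal_iff_toReal_lt (Lp.eLpNorm_ne_top _)).1 (lt_of_eq_of_lt ?_ hn2)
    refine eLpNorm_congr_ae ?_
    have : weakGrad D hD (u - v) = weakGrad D hD u - weakGrad D hD v :=
      (weakGrad D hD).map_sub u v
    rw [this]
    filter_upwards [hv2, Lp.coeFn_sub (weakGrad D hD u) (weakGrad D hD v)] with x hx hx'
    rw [hx', Pi.sub_apply, hx]
  linarith

end Norm

end TestFunctions

/-! ### Polar coordinates and averages over thin shells -/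

section Polar

/-- A radial estimate: the weight `r ^ (d - 1)` increases, so it can be moved under the integral of
the derivative over the outer part of the ray. -/
theorem ofReal_pow_mul_enorm_le_lintegral_fderiv {E : Type*} [NormedAddCommGroup E]
    [NormedSpace ℝ E] {φ : E → ℝ} (hφ : ContDiff ℝ 1 φ)
    (hc : HasCompactSupport φ) (k : ℕ) (θ : Metric.sphere (0 : E) 1) {r : ℝ} (hr : 0 < r) :
    ENNReal.ofReal (r ^ k) * ‖φ (r • (θ : E))‖ₑ ≤
      ∫⁻ s in Set.Ioi (0 : ℝ), ENNReal.ofReal (s ^ k) * ‖fderiv ℝ φ (s • (θ : E))‖ₑ := by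
  have hθ : ‖(θ : E)‖ = 1 := mem_sphere_zero_iff_norm.1 θ.2
  have hθ0 : (θ : E) ≠ 0 := norm_ne_zero_iff.1 (by rw [hθ]; exact one_ne_zero)
  have hf : ContDiff ℝ 1 fun s : ℝ => φ (s • (θ : E)) := hφ.comp (by fun_prop)
  have hcf : HasCompactSupport fun s : ℝ => φ (s • (θ : E)) :=
    hc.comp_isClosedEmbedding (isClosedEmbedding_smul_left hθ0)
  have hd : ∀ s : ℝ, ‖deriv (fun s : ℝ => φ (s • (θ : E))) s‖ₑ ≤ ‖fderiv ℝ φ (s • (θ : E))‖ₑ := by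
    intro s
    have h1 : HasDerivAt (fun s : ℝ => s • (θ : E)) (θ : E) s := by
      simpa using (hasDerivAt_id s).smul_const (θ : E)
    have h2 := ((hφ.differentiable one_ne_zero (s • (θ : E))).hasFDerivAt).comp_hasDerivAt s h1
    have h3 : deriv (fun s : ℝ => φ (s • (θ : E))) s = fderiv ℝ φ (s • (θ : E)) (θ : E) := h2.deriv
    rw [h3, enorm_le_iff_norm_le]
    simpa [hθ] using (fderiv ℝ φ (s • (θ : E))).le_opNorm (θ : E)
  have h0 : ‖φ (r • (θ : E))‖ₑ ≤ ∫⁻ s in Set.Ioi r, ‖fderiv ℝ φ (s • (θ : E))‖ₑ := by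
    have := hcf.integral_Ioi_deriv_eq hf r
    rw [← enorm_neg, ← this]
    exact (enorm_integral_le_lintegral_enorm _).trans (lintegral_mono hd)
  calc _ ≤ ENNReal.ofReal (r ^ k) * ∫⁻ s in Set.Ioi r, ‖fderiv ℝ φ (s • (θ : E))‖ₑ := by gcongr
    _ = ∫⁻ s in Set.Ioi r, ENNReal.ofReal (r ^ k) * ‖fderiv ℝ φ (s • (θ : E))‖ₑ :=
        (lintegral_const_mul' _ _ ENNReal.ofReal_ne_top).symm
    _ ≤ ∫⁻ s in Set.Ioi r, ENNReal.ofReal (s ^ k) * ‖fderiv ℝ φ (s • (θ : E))‖ₑ := by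
        refine setLIntegral_mono' measurableSet_Ioi fun s hs => ?_
        gcongr
        exact le_of_lt hs
    _ ≤ _ := lintegral_mono_set (Set.Ioi_subset_Ioi hr.le)

variable {E : Type*} [NormedAddCommGroup E] [NormedSpace ℝ E] [FiniteDimensional ℝ E]
  [MeasurableSpace E] [BorelSpace E] (μ : Measure E) [μ.IsAddHaarMeasure]

theorem lintegral_eq_lintegral_toSphere_lintegral [Nontrivial E] {f : E → ENNReal}
    (hf : Measurable f) :
    ∫⁻ x, f x ∂μ = ∫⁻ θ : Metric.sphere (0 : E) 1, (∫⁻ r in Set.Ioi (0 : ℝ),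
      ENNReal.ofReal (r ^ (Module.finrank ℝ E - 1)) * f (r • (θ : E))) ∂μ.toSphere := by
  have hg : Measurable fun p : Metric.sphere (0 : E) 1 × Set.Ioi (0 : ℝ) =>
      f ((p.2 : ℝ) • (p.1 : E)) := hf.comp (by fun_prop)
  calc ∫⁻ x, f x ∂μ = ∫⁻ x in ({0}ᶜ : Set E), f x ∂μ := by
        rw [restrict_compl_singleton]
    _ = ∫⁻ x : ({0}ᶜ : Set E), f x ∂(μ.comap (↑)) :=
        (lintegral_subtype_comap (measurableSet_singleton _).compl _).symm
    _ = ∫⁻ p, f ((p.2 : ℝ) • (p.1 : E))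
          ∂(μ.toSphere.prod (.volumeIoiPow (Module.finrank ℝ E - 1))) := by
        rw [← μ.measurePreserving_homeomorphUnitSphereProd.lintegral_comp_emb
          (Homeomorph.measurableEmbedding _)]
        refine lintegral_congr fun x => ?_
        rw [← homeomorphUnitSphereProd_symm_apply_coe, Homeomorph.symm_apply_apply]
    _ = _ := by
        rw [lintegral_prod _ hg.aemeasurable]
        refine lintegral_congr fun θ => ?_
        have hgθ : Measurable fun r : Set.Ioi (0 : ℝ) => f ((r : ℝ) • (θ : E)) :=
          hg.comp measurable_prodMk_left
        refine (lintegral_withDensity_eq_lintegral_mul _ (by fun_prop) hgθ).trans ?_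
        exact lintegral_subtype_comap measurableSet_Ioi
          fun r : ℝ => ENNReal.ofReal (r ^ (Module.finrank ℝ E - 1)) * f (r • (θ : E))

/-- The integral of a test function over a shell is at most the thickness of the shell times the
`L¹` norm of the derivative. -/
theorem lintegral_shell_le_lintegral_fderiv [Nontrivial E] {φ : E → ℝ} (hφ : ContDiff ℝ 1 φ)
    (hc : HasCompactSupport φ) (a b : ℝ) :
    ∫⁻ x in {x : E | a < ‖x‖ ∧ ‖x‖ < b}, ‖φ x‖ₑ ∂μ ≤
      ENNReal.ofReal (b - a) * ∫⁻ x, ‖fderiv ℝ φ x‖ₑ ∂μ := by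
  have hS : MeasurableSet {x : E | a < ‖x‖ ∧ ‖x‖ < b} :=
    (measurableSet_lt measurable_const measurable_norm).inter
      (measurableSet_lt measurable_norm measurable_const)
  have hm : Measurable fun x => ‖φ x‖ₑ := hφ.continuous.enorm.measurable
  rw [← lintegral_indicator hS, lintegral_eq_lintegral_toSphere_lintegral μ (hm.indicator hS),
    lintegral_eq_lintegral_toSphere_lintegral μ
      (hφ.continuous_fderiv one_ne_zero).enorm.measurable,
    ← lintegral_const_mul' _ _ ENNReal.ofReal_ne_top]
  refine lintegral_mono fun θ => ?_
  have hθ : ‖(θ : E)‖ = 1 := mem_sphere_zero_iff_norm.1 θ.2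
  calc _ ≤ ∫⁻ r in Set.Ioi (0 : ℝ), (Set.Ioo a b).indicator (fun _ =>
        ∫⁻ s in Set.Ioi (0 : ℝ), ENNReal.ofReal (s ^ (Module.finrank ℝ E - 1)) *
          ‖fderiv ℝ φ (s • (θ : E))‖ₑ) r := by
        refine setLIntegral_mono' measurableSet_Ioi fun r hr => ?_
        have hr : 0 < r := hr
        have hn : ‖r • (θ : E)‖ = r := by rw [norm_smul, hθ, mul_one, Real.norm_of_nonneg hr.le]
        by_cases h : r ∈ Set.Ioo a b
        · rw [Set.indicator_of_mem h, Set.indicator_of_mem (by simpa [hn] using h)]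
          exact ofReal_pow_mul_enorm_le_lintegral_fderiv hφ hc _ θ hr
        · rw [Set.indicator_of_notMem (by simpa [hn] using h), mul_zero]
          exact zero_le
    _ ≤ ∫⁻ r, (Set.Ioo a b).indicator (fun _ =>
        ∫⁻ s in Set.Ioi (0 : ℝ), ENNReal.ofReal (s ^ (Module.finrank ℝ E - 1)) *
          ‖fderiv ℝ φ (s • (θ : E))‖ₑ) r := setLIntegral_le_lintegral _ _
    _ = _ := by rw [lintegral_indicator_const measurableSet_Ioo, Real.volume_Ioo, mul_comm]

/-- The thin shell principle: if the part of an open set `W` in the shells `a < ‖x‖ < b` has volume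
at most `C (b - a)` as `b` decreases to `a`, then the part of `W` on the sphere of radius `a` has
area at most `C`. As `W` is open, it contains, with a point `a θ`, all `r θ` with `r` close
to `a`. -/
theorem ofReal_pow_mul_toSphere_le {W : Set E} (hW : IsOpen W) {a c : ℝ} (ha : 0 < a)
    (hac : a < c) {C : ENNReal}
    (h : ∀ b ∈ Set.Ioo a c, μ ({x | a < ‖x‖ ∧ ‖x‖ < b} ∩ W) ≤ ENNReal.ofReal (b - a) * C) :
    ENNReal.ofReal (a ^ (Module.finrank ℝ E - 1)) *
      μ.toSphere {θ | a • (θ : E) ∈ W} ≤ C := by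
  set k := Module.finrank ℝ E - 1
  -- `S j` is the set of directions `θ` such that `W` contains all `r θ` with `a ≤ r < b j`.
  set b : ℕ → ℝ := fun j => a + (c - a) / (j + 2) with hb
  have hca : 0 < c - a := sub_pos.2 hac
  have hbpos : ∀ j, 0 < b j - a := fun j => by
    rw [hb]; simp only [add_sub_cancel_left]; positivity
  have hbc : ∀ j, b j ∈ Set.Ioo a c := fun j => by
    refine ⟨by linarith [hbpos j], ?_⟩
    have : (c - a) / ((j : ℝ) + 2) < c - a :=
      div_lt_self hca (by linarith [(j.cast_nonneg : (0 : ℝ) ≤ j)])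
    simp only [hb]; linarith
  set S : ℕ → Set (Metric.sphere (0 : E) 1) := fun j =>
    {θ | ∀ r ∈ Set.Ico a (b j), r • (θ : E) ∈ W} with hS
  have hbanti : Antitone b := by
    intro i j hij
    simp only [hb]
    gcongr
  have hmono : Monotone S := fun i j hij θ hθ r hr => hθ r ⟨hr.1, hr.2.trans_le (hbanti hij)⟩
  have hblim : Tendsto b atTop (𝓝 a) := by
    have : Tendsto (fun j : ℕ => (c - a) / ((j : ℝ) + 2)) atTop (𝓝 0) :=
      tendsto_const_nhds.div_atTop (tendsto_atTop_add_const_right _ _ tendsto_natCast_atTop_atTop)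
    simpa using this.const_add a
  have hunion : {θ : Metric.sphere (0 : E) 1 | a • (θ : E) ∈ W} ⊆ ⋃ j, S j := by
    intro θ hθ
    have hcont : Continuous fun r : ℝ => r • (θ : E) := by fun_prop
    have hn : (fun r : ℝ => r • (θ : E)) ⁻¹' W ∈ 𝓝 a := (hW.preimage hcont).mem_nhds hθ
    obtain ⟨e, he, hsub⟩ := mem_nhdsGE_iff_exists_Ico_subset.1 (mem_nhdsWithin_of_mem_nhds hn)
    obtain ⟨j, hj⟩ := (hblim.eventually_lt_const he).exists
    exact Set.mem_iUnion.2 ⟨j, fun r hr => hsub ⟨hr.1, hr.2.trans hj⟩⟩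
  have hstep : ∀ j, ENNReal.ofReal (a ^ k) * μ.toSphere (S j) ≤ C := by
    intro j
    set I : Set (Set.Ioi (0 : ℝ)) := {r | a < (r : ℝ) ∧ (r : ℝ) < b j} with hI
    have hIm : (Subtype.val '' I : Set ℝ) = Set.Ioo a (b j) := by
      ext r
      simp only [hI, Set.mem_image, Set.mem_ofPred_eq, Subtype.exists, Set.mem_Ioi, Set.mem_Ioo]
      exact ⟨fun ⟨_, _, h, e⟩ => e ▸ h, fun h => ⟨r, ha.trans h.1, h, rfl⟩⟩
    have hIl : ENNReal.ofReal (a ^ k) * ENNReal.ofReal (b j - a) ≤ Measure.volumeIoiPow k I := by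
      have hImeas : MeasurableSet I :=
        (measurableSet_lt measurable_const measurable_subtype_coe).inter
          (measurableSet_lt measurable_subtype_coe measurable_const)
      rw [Measure.volumeIoiPow, withDensity_apply _ hImeas,
        setLIntegral_subtype measurableSet_Ioi _ fun r : ℝ => ENNReal.ofReal (r ^ k), hIm,
        ← Real.volume_Ioo, ← setLIntegral_const]
      refine setLIntegral_mono' measurableSet_Ioo fun r hr => ?_
      gcongr
      exact hr.1.le
    -- In polar coordinates, `S j × (a, b j)` is contained in the part of `W` in the shell. The sets
    -- `S j` need not be measurable, which `Measure.prod_prod` does not require.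
    have hprod : μ.toSphere (S j) * Measure.volumeIoiPow k I ≤
        μ ({x | a < ‖x‖ ∧ ‖x‖ < b j} ∩ W) := by
      rw [← Measure.prod_prod, ← μ.measurePreserving_homeomorphUnitSphereProd.measure_preimage_emb
        (Homeomorph.measurableEmbedding _),
        comap_subtype_coe_apply (measurableSet_singleton _).compl]
      refine measure_mono ?_
      rintro _ ⟨x, ⟨hx1, hx2⟩, rfl⟩
      have hx : (x : E) = (homeomorphUnitSphereProd E x).2.1 •
          ((homeomorphUnitSphereProd E x).1 : E) := by
        rw [← homeomorphUnitSphereProd_symm_apply_coe, Homeomorph.symm_apply_apply]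
      have hn : ((homeomorphUnitSphereProd E x).2 : ℝ) = ‖(x : E)‖ := by simp
      refine ⟨by simpa [hI, hn] using hx2, ?_⟩
      rw [hx]
      exact hx1 _ ⟨le_of_lt hx2.1, hx2.2⟩
    have h3 := hprod.trans (h _ (hbc j))
    have h4 : ENNReal.ofReal (b j - a) * (ENNReal.ofReal (a ^ k) * μ.toSphere (S j)) ≤
        ENNReal.ofReal (b j - a) * C := by
      refine le_trans ?_ h3
      calc _ = μ.toSphere (S j) * (ENNReal.ofReal (a ^ k) * ENNReal.ofReal (b j - a)) := by ring
        _ ≤ _ := by gcongr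
    exact (ENNReal.mul_le_mul_iff_right (ENNReal.ofReal_pos.2 (hbpos j)).ne'
      ENNReal.ofReal_ne_top).1 h4
  calc _ ≤ ENNReal.ofReal (a ^ k) * μ.toSphere (⋃ j, S j) := by gcongr
    _ = ⨆ j, ENNReal.ofReal (a ^ k) * μ.toSphere (S j) := by
        rw [hmono.measure_iUnion, ENNReal.mul_iSup]
    _ ≤ C := iSup_le hstep

end Polar

/-! ### Surface measures charge no exceptional set -/

section Exceptional

variable {d : ℕ} {D : Set (EuclideanSpace ℝ (Fin d))}

theorem lintegral_enorm_le_eLpNorm_two {F : Type*} [NormedAddCommGroup F] {α : Type*}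
    [MeasurableSpace α] {μ : Measure α} {f : α → F} (hf : AEStronglyMeasurable f μ) :
    ∫⁻ x, ‖f x‖ₑ ∂μ ≤ eLpNorm f 2 μ * μ Set.univ ^ (1 / 2 : ℝ) := by
  rw [← eLpNorm_one_eq_lintegral_enorm]
  refine (eLpNorm_le_eLpNorm_mul_rpow_measure_univ (q := 2) (by norm_num) hf).trans_eq ?_
  norm_num

theorem lebesgueOn_univ (hD : MeasurableSet D) : lebesgueOn D Set.univ = volume D := by
  rw [lebesgueOn, comap_subtype_coe_apply hD, Set.image_univ, Subtype.range_coe]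

/-- The shell estimate for test functions passes to the `H¹`-limit. -/
theorem lintegral_shell_le_weakGrad [NeZero d] (hD : IsOpen D) (hfin : volume D ≠ ⊤)
    (u : (classicalForm D hD).domain) (a b : ℝ) :
    ∫⁻ x in {x : D | a < ‖(x : EuclideanSpace ℝ (Fin d))‖ ∧
        ‖(x : EuclideanSpace ℝ (Fin d))‖ < b}, ‖(u : Lp ℝ 2 (lebesgueOn D)) x‖ₑ ∂(lebesgueOn D) ≤
      ENNReal.ofReal (b - a) * (‖weakGrad D hD u‖ₑ * volume D ^ (1 / 2 : ℝ)) := by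
  obtain ⟨φ, hφ, h1, h2⟩ := isTestLimit_weakGrad hD u
  set m := lebesgueOn D
  set V := volume D ^ (1 / 2 : ℝ) with hV
  have hVfin : V ≠ ⊤ := ENNReal.rpow_ne_top_of_nonneg (by norm_num) hfin
  have hmV : m Set.univ ^ (1 / 2 : ℝ) = V := by rw [lebesgueOn_univ hD.measurableSet]
  set S := {x : D | a < ‖(x : EuclideanSpace ℝ (Fin d))‖ ∧ ‖(x : EuclideanSpace ℝ (Fin d))‖ < b}
    with hS
  set B := ENNReal.ofReal (b - a)
  have hstep : ∀ n, ∫⁻ x in S, ‖(u : Lp ℝ 2 m) x‖ₑ ∂m ≤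
      eLpNorm (fun x : D => (u : Lp ℝ 2 m) x - φ n x) 2 m * V +
        B * ((eLpNorm (fun x : D => weakGrad D hD u x - ∇ (φ n) x) 2 m +
          ‖weakGrad D hD u‖ₑ) * V) := by
    intro n
    have m1 : AEStronglyMeasurable (fun x : D => (u : Lp ℝ 2 m) x - φ n x) m :=
      (Lp.aestronglyMeasurable _).sub ((hφ n).memLp hD).1
    have m2 : AEStronglyMeasurable (fun x : D => weakGrad D hD u x - ∇ (φ n) x) m :=
      (Lp.aestronglyMeasurable _).sub ((hφ n).memLp_gradient hD).1
    have e1 : ∫⁻ x in S, ‖(u : Lp ℝ 2 m) x - φ n x‖ₑ ∂m ≤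
        eLpNorm (fun x : D => (u : Lp ℝ 2 m) x - φ n x) 2 m * V :=
      (setLIntegral_le_lintegral _ _).trans
        ((lintegral_enorm_le_eLpNorm_two m1).trans_eq (by rw [hmV]))
    have e2 : ∫⁻ x : D, ‖∇ (φ n) x‖ₑ ∂m ≤
        (eLpNorm (fun x : D => weakGrad D hD u x - ∇ (φ n) x) 2 m + ‖weakGrad D hD u‖ₑ) * V := by
      have e3 : eLpNorm (fun x : D => ∇ (φ n) x) 2 m ≤
          eLpNorm (fun x : D => weakGrad D hD u x - ∇ (φ n) x) 2 m + ‖weakGrad D hD u‖ₑ := by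
        rw [Lp.enorm_def, add_comm]
        refine le_trans (le_of_eq ?_)
          (eLpNorm_sub_le (Lp.aestronglyMeasurable (weakGrad D hD u)) m2 (by norm_num))
        congr 1
        ext1 x
        simp
      refine (lintegral_enorm_le_eLpNorm_two ((hφ n).memLp_gradient hD).1).trans ?_
      rw [hmV]
      gcongr
    have e4 : ∫⁻ x in S, ‖φ n x‖ₑ ∂m ≤ B * ∫⁻ x : D, ‖∇ (φ n) x‖ₑ ∂m := by
      have hg : ∀ x, ‖∇ (φ n) x‖ₑ = ‖fderiv ℝ (φ n) x‖ₑ := fun x => by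
        rw [gradient, enorm_eq_iff_norm_eq, LinearIsometryEquiv.norm_map]
      calc ∫⁻ x in S, ‖φ n x‖ₑ ∂m
          = ∫⁻ x in (Subtype.val '' S), ‖φ n x‖ₑ :=
            setLIntegral_subtype hD.measurableSet S fun x => ‖φ n x‖ₑ
        _ ≤ ∫⁻ x in {x | a < ‖x‖ ∧ ‖x‖ < b}, ‖φ n x‖ₑ :=
            lintegral_mono_set (by rintro _ ⟨x, hx, rfl⟩; exact hx)
        _ ≤ B * ∫⁻ x, ‖fderiv ℝ (φ n) x‖ₑ :=
            lintegral_shell_le_lintegral_fderiv volume ((hφ n).1.of_le (by simp)) (hφ n).2.1 a b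
        _ = B * ∫⁻ x : D, ‖∇ (φ n) x‖ₑ ∂m := by
            congr 1
            rw [show m = volume.comap Subtype.val from rfl,
              lintegral_subtype_comap hD.measurableSet fun x => ‖∇ (φ n) x‖ₑ]
            simp_rw [← hg]
            refine (setLIntegral_eq_of_support_subset ?_).symm
            intro x hx
            by_contra h
            exact hx (by simp [(hφ n).gradient_eq_zero_of_notMem h])
    calc ∫⁻ x in S, ‖(u : Lp ℝ 2 m) x‖ₑ ∂m
        ≤ ∫⁻ x in S, (‖(u : Lp ℝ 2 m) x - φ n x‖ₑ + ‖φ n x‖ₑ) ∂m := by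
          refine lintegral_mono fun x => ?_
          simpa using enorm_add_le ((u : Lp ℝ 2 m) x - φ n x) (φ n x)
      _ = ∫⁻ x in S, ‖(u : Lp ℝ 2 m) x - φ n x‖ₑ ∂m + ∫⁻ x in S, ‖φ n x‖ₑ ∂m :=
          lintegral_add_left' m1.enorm.restrict _
      _ ≤ _ := add_le_add e1 (e4.trans (by gcongr))
  have t1 := ENNReal.Tendsto.mul_const (b := V) h1 (Or.inr hVfin)
  have t2 := ENNReal.Tendsto.const_mul (a := B)
    (ENNReal.Tendsto.mul_const (b := V) (h2.add_const ‖weakGrad D hD u‖ₑ) (Or.inr hVfin))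
    (Or.inr ENNReal.ofReal_ne_top)
  refine ge_of_tendsto' (x := atTop) ?_ hstep
  simpa using t1.add t2

theorem exists_isTestFunction_eq_one {r : ℝ} (hr : 0 < r) {R : ℝ} (hrR : r < R)
    (hRD : Metric.closedBall 0 R ⊆ D) :
    ∃ η, IsTestFunction D η ∧ (∀ x, 0 ≤ η x ∧ η x ≤ 1) ∧ ∀ x, ‖x‖ ≤ r → η x = 1 := by
  let η : ContDiffBump (0 : EuclideanSpace ℝ (Fin d)) := ⟨r, R, hr, hrR⟩
  refine ⟨η, ⟨η.contDiff, η.hasCompactSupport, ?_⟩, fun x => ⟨η.nonneg, η.le_one⟩, fun x hx => ?_⟩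
  · rwa [η.tsupport_eq]
  · exact η.one_of_mem_closedBall (mem_closedBall_zero_iff.2 hx)

theorem surfaceMeasure_apply {W : Set (EuclideanSpace ℝ (Fin d))} (hW : MeasurableSet W) (a : ℝ) :
    surfaceMeasure d a W = ENNReal.ofReal (a ^ (d - 1)) *
      (volume : Measure (EuclideanSpace ℝ (Fin d))).toSphere
        {θ | a • (θ : EuclideanSpace ℝ (Fin d)) ∈ W} := by
  rw [surfaceMeasure, Measure.smul_apply, Measure.map_apply (by fun_prop) hW, smul_eq_mul]
  rfl

/-- If `v ∈ H¹₀(D)` vanishes off `F` and is close to a cutoff function `η`, then `D \ F` has small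
area on the spheres on whose neighbourhood `η = 1`. -/
theorem surfaceMeasure_compl_le [NeZero d] (hD : IsOpen D) (hfin : volume D ≠ ⊤)
    {η : EuclideanSpace ℝ (Fin d) → ℝ} {a c : ℝ} (ha : 0 < a) (hac : a < c)
    (hη1 : ∀ x, ‖x‖ ≤ c → η x = 1)
    {u v : (classicalForm D hD).domain}
    (hu : (u : Lp ℝ 2 (lebesgueOn D)) =ᵐ[lebesgueOn D] fun x => η x) {F : Set D}
    (hF : IsClosed F) (hv : v ∈ (classicalForm D hD).domainOn F) :
    surfaceMeasure d a (Subtype.val '' Fᶜ) ≤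
      ENNReal.ofReal (2 * (classicalForm D hD).norm1 (u - v)) * volume D ^ (1 / 2 : ℝ) := by
  have hW : IsOpen (Subtype.val '' Fᶜ : Set (EuclideanSpace ℝ (Fin d))) :=
    hD.isOpenMap_subtype_val _ hF.isOpen_compl
  have hfr : Module.finrank ℝ (EuclideanSpace ℝ (Fin d)) = d := by simp
  rw [surfaceMeasure_apply hW.measurableSet]
  have key := ofReal_pow_mul_toSphere_le (volume : Measure (EuclideanSpace ℝ (Fin d))) hW ha hac
    (C := ENNReal.ofReal (2 * (classicalForm D hD).norm1 (u - v)) * volume D ^ (1 / 2 : ℝ)) ?_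
  · rwa [hfr] at key
  intro b hb
  have hset : {x : EuclideanSpace ℝ (Fin d) | a < ‖x‖ ∧ ‖x‖ < b} ∩ Subtype.val '' Fᶜ =
      Subtype.val '' ({x : D | a < ‖(x : EuclideanSpace ℝ (Fin d))‖ ∧
        ‖(x : EuclideanSpace ℝ (Fin d))‖ < b} ∩ Fᶜ) :=
    Set.inter_comm _ _ |>.trans ((Set.image_inter_preimage _ _ _).symm.trans
      (congrArg _ (Set.inter_comm _ _)))
  have hSm : MeasurableSet {x : D | a < ‖(x : EuclideanSpace ℝ (Fin d))‖ ∧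
        ‖(x : EuclideanSpace ℝ (Fin d))‖ < b} :=
    (measurableSet_lt measurable_const measurable_subtype_coe.norm).inter
      (measurableSet_lt measurable_subtype_coe.norm measurable_const)
  rw [hset, ← comap_subtype_coe_apply hD.measurableSet]
  change lebesgueOn D _ ≤ _
  calc lebesgueOn D _ = ∫⁻ x in _ ∩ Fᶜ, 1 ∂(lebesgueOn D) := (setLIntegral_one _).symm
    _ ≤ ∫⁻ x in {x : D | a < ‖(x : EuclideanSpace ℝ (Fin d))‖ ∧
        ‖(x : EuclideanSpace ℝ (Fin d))‖ < b} ∩ Fᶜ,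
          ‖((u - v : (classicalForm D hD).domain) : Lp ℝ 2 (lebesgueOn D)) x‖ₑ
          ∂(lebesgueOn D) := by
        refine lintegral_mono_ae
          ((ae_restrict_iff' (hSm.inter hF.isOpen_compl.measurableSet)).2 ?_)
        filter_upwards [hu, hv, Lp.coeFn_sub (u : Lp ℝ 2 (lebesgueOn D)) v] with x h1 h2 h3 hx
        rw [Submodule.coe_sub, h3, Pi.sub_apply, h1, h2 hx.2, hη1 x (hx.1.2.le.trans hb.2.le)]
        simp
    _ ≤ _ := lintegral_mono_set Set.inter_subset_left
    _ ≤ _ := lintegral_shell_le_weakGrad hD hfin (u - v) a b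
    _ ≤ _ := by
        gcongr
        rw [← ofReal_norm]
        exact ENNReal.ofReal_le_ofReal (norm_weakGrad_le hD _)

/-- The surface measure of a sphere inside `D` charges no exceptional set. -/
theorem surfaceMeasure_eq_zero_of_isExceptional [NeZero d] (hD : IsOpen D) (hfin : volume D ≠ ⊤)
    {a R : ℝ} (ha : 0 < a) (haR : a < R) (hRD : Metric.closedBall 0 R ⊆ D) {B : Set D}
    (hB : (classicalForm D hD).IsExceptional B) :
    surfaceMeasure d a (Subtype.val '' B) = 0 := by
  obtain ⟨F, hF, hBF⟩ := hB
  obtain ⟨η, hη, -, hη1⟩ := exists_isTestFunction_eq_one (r := (a + R) / 2) (by linarith)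
    (by linarith) hRD
  obtain ⟨u, hu, -⟩ := hη.exists_mem_domain hD
  have hVfin : volume D ^ (1 / 2 : ℝ) ≠ ⊤ := ENNReal.rpow_ne_top_of_nonneg (by norm_num) hfin
  have hle : ∀ n : ℕ, surfaceMeasure d a (Subtype.val '' B) ≤
      ENNReal.ofReal (2 * (1 / ((n : ℝ) + 1))) * volume D ^ (1 / 2 : ℝ) := by
    intro n
    obtain ⟨k, v, hv, hlt⟩ := hF.dense u (1 / ((n : ℝ) + 1)) (by positivity)
    refine (measure_mono (Set.image_mono (hBF.trans (Set.iInter_subset _ k)))).trans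
      ((surfaceMeasure_compl_le hD hfin ha (by linarith) hη1 hu (hF.isClosed k) hv).trans ?_)
    gcongr
  have hlim : Tendsto (fun n : ℕ => ENNReal.ofReal (2 * (1 / ((n : ℝ) + 1))) *
      volume D ^ (1 / 2 : ℝ)) atTop (𝓝 0) := by
    have := ENNReal.Tendsto.mul_const (b := volume D ^ (1 / 2 : ℝ))
      (ENNReal.tendsto_ofReal ((tendsto_one_div_add_atTop_nhds_zero_nat (𝕜 := ℝ)).const_mul 2))
      (Or.inr hVfin)
    simpa using this
  exact le_antisymm (ge_of_tendsto' hlim hle) zero_le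

end Exceptional

/-! ### Nests of compact sets -/

section Nest

variable {d : ℕ} {D : Set (EuclideanSpace ℝ (Fin d))}

theorem L2Form.isNest_univ {E : Type*} [TopologicalSpace E] [MeasurableSpace E] {m : Measure E}
    (𝓔 : L2Form m) : 𝓔.IsNest fun _ => Set.univ where
  isClosed _ := isClosed_univ
  monotone := monotone_const
  dense u ε hε := by
    refine ⟨0, u, ae_of_all _ fun x hx => (hx trivial).elim, ?_⟩
    simpa [L2Form.norm1, L2Form.form1] using hε

theorem L2Form.isQuasiContinuous_of_continuous {E : Type*} [TopologicalSpace E]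
    [MeasurableSpace E] {m : Measure E} (𝓔 : L2Form m) {f : E → ℝ} (hf : Continuous f) :
    𝓔.IsQuasiContinuous f :=
  ⟨_, 𝓔.isNest_univ, fun _ => hf.continuousOn⟩

theorem isNest_compactExhaustion (hD : IsOpen D) (K : CompactExhaustion D) :
    (classicalForm D hD).IsNest K where
  isClosed k := (K.isCompact k).isClosed
  monotone := fun _ _ h => K.subset h
  dense u ε hε := by
    obtain ⟨φ, hφ, v, hv, hlt⟩ := exists_test_norm1_sub_lt hD u hε
    obtain ⟨k, hk⟩ := K.exists_superset_of_isCompact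
      (IsInducing.subtypeVal.isCompact_preimage' hφ.2.1.isCompact
        (Subtype.range_coe.symm ▸ hφ.2.2))
    refine ⟨k, v, ?_, hlt⟩
    filter_upwards [hv] with x hx hxk
    rw [hx]
    exact image_eq_zero_of_notMem_tsupport fun h => hxk (hk h)

theorem isSmooth_of_isFiniteMeasure (hD : IsOpen D) (μ : Measure D) [IsFiniteMeasure μ]
    (h : ∀ B, MeasurableSet B → (classicalForm D hD).IsExceptional B → μ B = 0) :
    (classicalForm D hD).IsSmooth μ := by
  have : LocallyCompactSpace D := hD.locallyCompactSpace
  let K : CompactExhaustion D := default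
  exact ⟨h, K, isNest_compactExhaustion hD K, fun k => ⟨K.isCompact k, measure_lt_top _ _⟩⟩

end Nest

/-! ### The sum of surface measures is a bounded smooth measure -/

section SphereSum

/-- The radius `(n + 1) ^ (-1/4)` of the sphere that carries the `n`-th summand of `sphereSum`. -/
noncomputable def sphereRadius (n : ℕ) : ℝ := ((n : ℝ) + 1) ^ (-(1 / 4) : ℝ)

theorem sphereRadius_pos (n : ℕ) : 0 < sphereRadius n := by
  unfold sphereRadius; positivity

theorem sphereRadius_pow_four (n : ℕ) : sphereRadius n ^ 4 = 1 / ((n : ℝ) + 1) := by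
  rw [sphereRadius, ← Real.rpow_natCast, ← Real.rpow_mul (by positivity),
    show -(1 / 4) * ((4 : ℕ) : ℝ) = -1 by norm_num, Real.rpow_neg_one, one_div]

theorem sphereRadius_pow_six (n : ℕ) :
    sphereRadius n ^ 6 = (((n + 1 : ℕ) : ℝ)) ^ (-(3 / 2) : ℝ) := by
  rw [sphereRadius, ← Real.rpow_natCast, ← Real.rpow_mul (by positivity)]
  push_cast
  norm_num

theorem sphereRadius_zero : sphereRadius 0 = 1 := by simp [sphereRadius]

theorem sphereRadius_antitone : Antitone sphereRadius := fun m n h =>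
  Real.rpow_le_rpow_of_nonpos (by positivity) (by gcongr) (by norm_num)

theorem sphereRadius_lt_one {n : ℕ} (hn : n ≠ 0) : sphereRadius n < 1 :=
  Real.rpow_lt_one_of_one_lt_of_neg
    (by have : (0 : ℝ) < n := Nat.cast_pos.2 (Nat.pos_of_ne_zero hn); linarith) (by norm_num)

theorem sphereRadius_le_half {n : ℕ} (hn : 15 ≤ n) : sphereRadius n ≤ 1 / 2 := by
  have h1 : (15 : ℝ) ≤ n := by exact_mod_cast hn
  refine le_of_pow_le_pow_left₀ (n := 4) (by norm_num) (by norm_num) ?_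
  rw [sphereRadius_pow_four, div_le_iff₀ (by positivity)]
  linarith

theorem sphereSum_eq : sphereSum =
    Measure.sum fun n => (surfaceMeasure 7 (sphereRadius n)).comap Subtype.val := rfl

theorem sphereSum_apply {B : Set unitBall7} (hB : MeasurableSet B) :
    sphereSum B = ∑' n, surfaceMeasure 7 (sphereRadius n) (Subtype.val '' B) := by
  rw [sphereSum_eq, Measure.sum_apply _ hB]
  simp_rw [comap_subtype_coe_apply isOpen_unitBall7.measurableSet]

theorem isFiniteMeasure_sphereSum : IsFiniteMeasure sphereSum := by
  constructor
  set τ := (volume : Measure (EuclideanSpace ℝ (Fin 7))).toSphere Set.univ with hτ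
  rw [sphereSum_apply .univ]
  have hle : ∀ n, surfaceMeasure 7 (sphereRadius n) (Subtype.val '' (Set.univ : Set unitBall7)) ≤
      ENNReal.ofReal (((n + 1 : ℕ) : ℝ) ^ (-(3 / 2) : ℝ)) * τ := fun n => by
    refine (measure_mono (Set.subset_univ _)).trans ?_
    rw [surfaceMeasure_apply .univ, ← sphereRadius_pow_six]
    rfl
  refine (ENNReal.tsum_le_tsum hle).trans_lt ?_
  rw [ENNReal.tsum_mul_right]
  have hsum : Summable fun n : ℕ => (((n + 1 : ℕ) : ℝ)) ^ (-(3 / 2) : ℝ) :=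
    (summable_nat_add_iff 1).2 (Real.summable_nat_rpow.2 (by norm_num))
  exact ENNReal.mul_lt_top hsum.tsum_ofReal_lt_top (measure_lt_top _ _)

theorem surfaceMeasure_eq_zero_of_subset_ball {d : ℕ} {a : ℝ} (ha : 0 ≤ a)
    {B : Set (EuclideanSpace ℝ (Fin d))} (hB : B ⊆ Metric.ball 0 a) :
    surfaceMeasure d a B = 0 := by
  refine measure_mono_null hB ?_
  rw [surfaceMeasure_apply Metric.isOpen_ball.measurableSet]
  have : {θ : Metric.sphere (0 : EuclideanSpace ℝ (Fin d)) 1 |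
      a • (θ : EuclideanSpace ℝ (Fin d)) ∈ Metric.ball 0 a} = ∅ := by
    ext θ
    simp [norm_smul, abs_of_nonneg ha]
  rw [this, measure_empty, mul_zero]

theorem volume_unitBall7_ne_top : volume unitBall7 ≠ ⊤ := measure_ball_lt_top.ne

theorem isSmooth_sphereSum : (classicalForm unitBall7 isOpen_unitBall7).IsSmooth sphereSum := by
  have := isFiniteMeasure_sphereSum
  refine isSmooth_of_isFiniteMeasure _ _ fun B hB hex => ?_
  rw [sphereSum_apply hB, ENNReal.tsum_eq_zero]
  intro n
  rcases eq_or_ne n 0 with rfl | hn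
  · -- The sphere of radius `1` lies outside the open ball.
    rw [sphereRadius_zero]
    exact surfaceMeasure_eq_zero_of_subset_ball zero_le_one (by rintro _ ⟨x, -, rfl⟩; exact x.2)
  · obtain ⟨R, h1, h2⟩ := exists_between (sphereRadius_lt_one hn)
    exact surfaceMeasure_eq_zero_of_isExceptional _ volume_unitBall7_ne_top (sphereRadius_pos n) h1
      (Metric.closedBall_subset_ball h2) hex

theorem totalVariation_toSignedMeasure {α : Type*} [MeasurableSpace α] (μ : Measure α)
    [IsFiniteMeasure μ] : μ.toSignedMeasure.totalVariation = μ := by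
  let j : JordanDecomposition α := ⟨μ, 0, Measure.MutuallySingular.zero_right⟩
  have hj : j.toSignedMeasure = μ.toSignedMeasure := by
    simp [j, JordanDecomposition.toSignedMeasure]
  rw [SignedMeasure.totalVariation, ← hj, JordanDecomposition.toJordanDecomposition_toSignedMeasure]
  simp [j]

end SphereSum

/-! ### The part of a signed measure on a null set -/

/-- Let `μ = f dm + ν` with `μ` carried by an `m`-null set. On that set `μ = ν`, so that
`ν = ν₁ - ν₂` forces `μ ≤ ν₁`. -/
theorem le_of_toSignedMeasure_eq_withDensityᵥ_add {α : Type*} [MeasurableSpace α]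
    {μ m ν₁ ν₂ : Measure α} [IsFiniteMeasure μ] {A : Set α} (hA : MeasurableSet A) (hm : m A = 0)
    (hμ : μ Aᶜ = 0) {f : α → ℝ} (hf : Integrable f m) {ν : SignedMeasure α}
    (h : μ.toSignedMeasure = m.withDensityᵥ f + ν)
    (hν : ν.toJordanDecomposition.posPart + ν₂ = ν.toJordanDecomposition.negPart + ν₁) :
    μ ≤ ν₁ := by
  refine Measure.le_iff.2 fun s hs => ?_
  have hC : MeasurableSet (s ∩ A) := hs.inter hA
  have hm0 : m (s ∩ A) = 0 := measure_mono_null Set.inter_subset_right hm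
  have hμs : μ s = μ (s ∩ A) := by
    rw [← measure_inter_add_sdiff s hA,
      measure_mono_null (s := s \ A) (fun x hx => hx.2) hμ, add_zero]
  have h1 : μ.real (s ∩ A) = ν.toJordanDecomposition.posPart.real (s ∩ A) -
      ν.toJordanDecomposition.negPart.real (s ∩ A) := by
    rw [← ν.apply_eq_posPart_real_sub_negPart_real hC,
      ← Measure.toSignedMeasure_apply_measurable hC, h, add_apply,
      withDensityᵥ_apply hf hC, setIntegral_measure_zero _ hm0, zero_add]
  have h2 : ν.toJordanDecomposition.posPart (s ∩ A) =
      ν.toJordanDecomposition.negPart (s ∩ A) + μ (s ∩ A) := by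
    rw [← ENNReal.toReal_eq_toReal_iff' (measure_ne_top _ _)
      (ENNReal.add_ne_top.2 ⟨measure_ne_top _ _, measure_ne_top _ _⟩),
      ENNReal.toReal_add (measure_ne_top _ _) (measure_ne_top _ _)]
    simp only [Measure.real] at h1
    linarith
  have h3 := congrArg (fun κ : Measure α => κ (s ∩ A)) hν
  simp only [Measure.add_apply, h2, add_assoc] at h3
  have h4 := (ENNReal.add_right_inj (measure_ne_top _ _)).1 h3
  calc μ s = μ (s ∩ A) := hμs
    _ ≤ ν₁ (s ∩ A) := le_self_add.trans h4.le
    _ ≤ ν₁ s := measure_mono Set.inter_subset_left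

/-! ### The sum of surface measures has infinite energy -/

section Energy

theorem norm_fderiv_inv_norm_sq_add_le {E : Type*} [NormedAddCommGroup E] [InnerProductSpace ℝ E]
    {ε : ℝ} (hε : 0 < ε) {x : E} (hx : x ≠ 0) :
    ‖fderiv ℝ (fun y : E => (‖y‖ ^ 2 + ε)⁻¹) x‖ ≤ 2 * (‖x‖ ^ 3)⁻¹ := by
  have hx0 : 0 < ‖x‖ := norm_pos_iff.2 hx
  have h1 : HasFDerivAt (fun y : E => ‖y‖ ^ 2 + ε) (2 • innerSL ℝ x) x :=
    (hasStrictFDerivAt_norm_sq x).hasFDerivAt.add_const ε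
  have h2 : HasFDerivAt (fun y : E => (‖y‖ ^ 2 + ε)⁻¹)
      ((-((‖x‖ ^ 2 + ε) ^ 2)⁻¹) • (2 • innerSL ℝ x)) x :=
    (hasDerivAt_inv (by positivity : ‖x‖ ^ 2 + ε ≠ 0)).comp_hasFDerivAt x h1
  rw [h2.fderiv, norm_smul, norm_neg, Real.norm_of_nonneg (by positivity),
    ← Nat.cast_smul_eq_nsmul ℝ, norm_smul, innerSL_apply_norm]
  calc ((‖x‖ ^ 2 + ε) ^ 2)⁻¹ * (‖((2 : ℕ) : ℝ)‖ * ‖x‖) ≤ ((‖x‖ ^ 2) ^ 2)⁻¹ * (2 * ‖x‖) := by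
        gcongr
        · linarith
        · simp
    _ = 2 * (‖x‖ ^ 3)⁻¹ := by field_simp

theorem contDiff_inv_norm_sq_add {E : Type*} [NormedAddCommGroup E] [InnerProductSpace ℝ E]
    {ε : ℝ} (hε : 0 < ε) : ContDiff ℝ ∞ fun y : E => (‖y‖ ^ 2 + ε)⁻¹ :=
  ((contDiff_norm_sq ℝ).add contDiff_const).inv fun _ => by positivity

/-- `‖x‖⁻³` is square integrable on the unit ball of `ℝ⁷`, as `6 < 7`. -/
theorem memLp_two_inv_norm_cube :
    MemLp (fun x : unitBall7 => (‖(x : EuclideanSpace ℝ (Fin 7))‖ ^ 3)⁻¹) 2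
      (lebesgueOn unitBall7) := by
  have h : MemLp (fun x : EuclideanSpace ℝ (Fin 7) => (‖x‖ ^ 3)⁻¹) 2
      (volume.restrict unitBall7) := by
    rw [memLp_two_iff_integrable_sq (by fun_prop)]
    refine (integrableOn_fun_norm_addHaar volume (f := fun y : ℝ => ((y ^ 3)⁻¹) ^ 2)).2 ?_
    refine (integrableOn_const (C := (1 : ℝ)) (by simp)).congr_fun ?_ measurableSet_Ioo
    intro y hy
    have : y ≠ 0 := hy.1.ne'
    simp only [finrank_euclideanSpace, Fintype.card_fin, smul_eq_mul]
    field_simp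
  exact h.comp_measurePreserving (lebesgueOn_measurePreserving isOpen_unitBall7.measurableSet)

/-- Cutoffs of `(‖x‖² + ε)⁻¹` are bounded in `H¹₀` of the unit ball of `ℝ⁷`, uniformly in `ε`:
the functions and their gradients are dominated by a multiple of `‖x‖⁻³`. -/
theorem exists_test_inv_norm_sq_add_bound : ∃ K : ℝ, ∀ ε : ℝ, 0 < ε → ∃ ψ,
    IsTestFunction unitBall7 ψ ∧ (∀ x, ‖x‖ ≤ 1 / 2 → ψ x = (‖x‖ ^ 2 + ε)⁻¹) ∧
    ∃ u : (classicalForm unitBall7 isOpen_unitBall7).domain,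
      ((u : Lp ℝ 2 (lebesgueOn unitBall7)) =ᵐ[lebesgueOn unitBall7] fun x => ψ x) ∧
      (classicalForm unitBall7 isOpen_unitBall7).norm1 u ≤ K := by
  obtain ⟨η, hη, hη01, hη1⟩ := exists_isTestFunction_eq_one (d := 7) (D := unitBall7)
    (r := 1 / 2) (by norm_num) (R := 3 / 4) (by norm_num)
    (Metric.closedBall_subset_ball (by norm_num))
  obtain ⟨M, hM⟩ := (hη.2.1.fderiv ℝ).exists_bound_of_continuous
    (hη.1.continuous_fderiv (by simp))
  have hM0 : 0 ≤ M := (norm_nonneg _).trans (hM 0)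
  set m := lebesgueOn unitBall7 with hm
  set g : unitBall7 → ℝ := fun x => (M + 2) * (‖(x : EuclideanSpace ℝ (Fin 7))‖ ^ 3)⁻¹ with hg
  have hgL : MemLp g 2 m := memLp_two_inv_norm_cube.const_mul (M + 2)
  refine ⟨2 * (eLpNorm g 2 m).toReal, fun ε hε => ?_⟩
  set w : EuclideanSpace ℝ (Fin 7) → ℝ := fun y => (‖y‖ ^ 2 + ε)⁻¹ with hw
  have hwc : ContDiff ℝ ∞ w := contDiff_inv_norm_sq_add hε
  have hψ : IsTestFunction unitBall7 (fun x => η x * w x) :=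
    ⟨hη.1.mul hwc, hη.2.1.mul_right, (tsupport_mul_subset_left (f := η) (g := w)).trans hη.2.2⟩
  obtain ⟨u, hu, hgu⟩ := hψ.exists_mem_domain isOpen_unitBall7
  refine ⟨_, hψ, fun x hx => by rw [hη1 x hx, one_mul], u, hu, ?_⟩
  have hne : ∀ᵐ x : unitBall7 ∂m, (x : EuclideanSpace ℝ (Fin 7)) ≠ 0 := by
    have h0 : ∀ᵐ x ∂(volume.restrict unitBall7), x ≠ (0 : EuclideanSpace ℝ (Fin 7)) :=
      Measure.ae_ne _ _
    exact (lebesgueOn_measurePreserving isOpen_unitBall7.measurableSet).quasiMeasurePreserving.ae h0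
  have hcube : ∀ x : unitBall7, (x : EuclideanSpace ℝ (Fin 7)) ≠ 0 →
      0 < ‖(x : EuclideanSpace ℝ (Fin 7))‖ ∧
      w x ≤ (‖(x : EuclideanSpace ℝ (Fin 7))‖ ^ 3)⁻¹ ∧ 0 ≤ w x := by
    intro x hx
    have hx0 : 0 < ‖(x : EuclideanSpace ℝ (Fin 7))‖ := norm_pos_iff.2 hx
    have hx1 : ‖(x : EuclideanSpace ℝ (Fin 7))‖ ≤ 1 := (mem_ball_zero_iff.1 x.2).le
    refine ⟨hx0, ?_, by positivity⟩
    refine inv_anti₀ (by positivity) ?_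
    nlinarith [pow_le_pow_of_le_one hx0.le hx1 (show 2 ≤ 3 by norm_num)]
  have b1 : ‖(u : Lp ℝ 2 m)‖ ≤ (eLpNorm g 2 m).toReal := by
    rw [Lp.norm_def]
    refine ENNReal.toReal_mono hgL.eLpNorm_ne_top (eLpNorm_mono_ae_real ?_)
    filter_upwards [hu, hne] with x hx hx0
    obtain ⟨h1, h2, h3⟩ := hcube x hx0
    rw [hx, norm_mul, Real.norm_of_nonneg (hη01 x).1, Real.norm_of_nonneg h3]
    calc η x * w x ≤ 1 * (‖(x : EuclideanSpace ℝ (Fin 7))‖ ^ 3)⁻¹ := by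
          gcongr
          exact (hη01 x).2
      _ ≤ g x := by
          simp only [hg]
          gcongr
          linarith
  have b2 : ‖weakGrad unitBall7 isOpen_unitBall7 u‖ ≤ (eLpNorm g 2 m).toReal := by
    rw [Lp.norm_def]
    refine ENNReal.toReal_mono hgL.eLpNorm_ne_top (eLpNorm_mono_ae_real ?_)
    filter_upwards [hgu, hne] with x hx hx0
    obtain ⟨h1, h2, h3⟩ := hcube x hx0
    rw [hx, gradient, LinearIsometryEquiv.norm_map,
      fderiv_fun_mul (hη.differentiable x) (hwc.differentiable (by simp) x)]
    calc _ ≤ ‖η x • fderiv ℝ w x‖ + ‖w x • fderiv ℝ η x‖ := norm_add_le _ _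
      _ = η x * ‖fderiv ℝ w x‖ + w x * ‖fderiv ℝ η x‖ := by
          rw [norm_smul, norm_smul, Real.norm_of_nonneg (hη01 x).1, Real.norm_of_nonneg h3]
      _ ≤ 1 * (2 * (‖(x : EuclideanSpace ℝ (Fin 7))‖ ^ 3)⁻¹) +
          (‖(x : EuclideanSpace ℝ (Fin 7))‖ ^ 3)⁻¹ * M := by
          gcongr
          · exact (hη01 x).2
          · exact norm_fderiv_inv_norm_sq_add_le hε hx0
          · exact hM x
      _ = g x := by simp only [hg]; ring
  linarith [classicalForm_norm1_le isOpen_unitBall7 u]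

theorem lintegral_comap_surfaceMeasure {d : ℕ} {D : Set (EuclideanSpace ℝ (Fin d))}
    (hD : MeasurableSet D) {a : ℝ} (ha : 0 ≤ a)
    (haD : Metric.sphere 0 a ⊆ D) {g : EuclideanSpace ℝ (Fin d) → ENNReal} (hg : Measurable g) :
    ∫⁻ x : D, g x ∂((surfaceMeasure d a).comap Subtype.val) =
      ENNReal.ofReal (a ^ (d - 1)) *
        ∫⁻ θ, g (a • (θ : EuclideanSpace ℝ (Fin d)))
          ∂(volume : Measure (EuclideanSpace ℝ (Fin d))).toSphere := by
  have hm : Measurable fun θ : Metric.sphere (0 : EuclideanSpace ℝ (Fin d)) 1 =>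
      a • (θ : EuclideanSpace ℝ (Fin d)) := by fun_prop
  rw [lintegral_subtype_comap hD, ← lintegral_indicator hD, surfaceMeasure, lintegral_smul_measure,
    lintegral_map (hg.indicator hD) hm, smul_eq_mul]
  congr 1
  refine lintegral_congr fun θ => Set.indicator_of_mem (haD ?_) _
  simp [norm_smul, abs_of_nonneg ha]

/-- The sum of the surface measures has infinite energy: tested against the cutoff of
`(‖x‖² + ε)⁻¹` with `ε` the square of the smallest radius, the first `N` small spheres
contribute at least a multiple of `∑ n, a_n⁶ / (2 a_n²) = ∑ n, 1 / (2 (n + 1))`. -/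
theorem not_exists_energy_bound_sphereSum (C : ℝ) :
    ¬ ∀ ε : ℝ, 0 < ε → ∃ ψ, IsTestFunction unitBall7 ψ ∧
      (∀ x, ‖x‖ ≤ 1 / 2 → ψ x = (‖x‖ ^ 2 + ε)⁻¹) ∧
      ∫⁻ x : unitBall7, ‖ψ x‖ₑ ∂sphereSum ≤ ENNReal.ofReal C := by
  intro h
  set τ := (volume : Measure (EuclideanSpace ℝ (Fin 7))).toSphere Set.univ with hτ
  have hτtop : τ ≠ ⊤ := measure_ne_top _ _
  have hτ0 : 0 < τ.toReal := ENNReal.toReal_pos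
    (Measure.measure_univ_ne_zero.2 (Measure.toSphere_ne_zero _)) hτtop
  -- Radii with index at least `15` are at most `1 / 2`, where the cutoff equals `1`.
  have hterm : ∀ n N : ℕ, 15 ≤ n → n ≤ N → ∀ ψ : EuclideanSpace ℝ (Fin 7) → ℝ,
      IsTestFunction unitBall7 ψ →
      (∀ x, ‖x‖ ≤ 1 / 2 → ψ x = (‖x‖ ^ 2 + sphereRadius N ^ 2)⁻¹) →
      ENNReal.ofReal (1 / (2 * ((n : ℝ) + 1)) * τ.toReal) ≤
        ∫⁻ x : unitBall7, ‖ψ x‖ₑ ∂((surfaceMeasure 7 (sphereRadius n)).comap Subtype.val) := by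
    intro n N hn hnN ψ hψ hψ1
    have ha := sphereRadius_pos n
    have ha2 := sphereRadius_le_half hn
    have haN := sphereRadius_antitone hnN
    have haN0 := sphereRadius_pos N
    rw [lintegral_comap_surfaceMeasure isOpen_unitBall7.measurableSet ha.le
      ((Metric.sphere_subset_closedBall).trans (Metric.closedBall_subset_ball (by linarith)))
      (g := fun x => ‖ψ x‖ₑ) hψ.1.continuous.enorm.measurable]
    have hval : ∀ θ : Metric.sphere (0 : EuclideanSpace ℝ (Fin 7)) 1,
        ‖ψ (sphereRadius n • (θ : EuclideanSpace ℝ (Fin 7)))‖ₑ =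
          ENNReal.ofReal ((sphereRadius n ^ 2 + sphereRadius N ^ 2)⁻¹) := by
      intro θ
      have hn : ‖sphereRadius n • (θ : EuclideanSpace ℝ (Fin 7))‖ = sphereRadius n := by
        simp [norm_smul, abs_of_pos ha]
      rw [hψ1 _ (by rw [hn]; exact ha2), hn, Real.enorm_of_nonneg (by positivity)]
    simp_rw [hval]
    rw [lintegral_const, ← hτ, ← ENNReal.ofReal_toReal hτtop,
      ENNReal.toReal_ofReal ENNReal.toReal_nonneg, ← mul_assoc,
      ← ENNReal.ofReal_mul (by positivity), ← ENNReal.ofReal_mul (by positivity)]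
    refine ENNReal.ofReal_le_ofReal (mul_le_mul_of_nonneg_right ?_ hτ0.le)
    calc 1 / (2 * ((n : ℝ) + 1))
        = sphereRadius n ^ 6 * (sphereRadius n ^ 2 + sphereRadius n ^ 2)⁻¹ := by
          rw [one_div, mul_inv, ← one_div ((n : ℝ) + 1), ← sphereRadius_pow_four]
          field_simp
          norm_num
      _ ≤ sphereRadius n ^ (7 - 1) * (sphereRadius n ^ 2 + sphereRadius N ^ 2)⁻¹ := by
          gcongr
  have hbound : ∀ k : ℕ, ∑ i ∈ Finset.range k, 1 / (2 * (((i + 15 : ℕ) : ℝ) + 1)) * τ.toReal ≤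
      max C 0 := by
    intro k
    obtain ⟨ψ, hψ, hψ1, hle⟩ := h (sphereRadius (k + 15) ^ 2) (pow_pos (sphereRadius_pos _) 2)
    rw [← ENNReal.ofReal_le_ofReal_iff (le_max_right _ _), ENNReal.ofReal_sum_of_nonneg
      (fun i _ => by positivity)]
    calc _ ≤ ∑ i ∈ Finset.range k, ∫⁻ x : unitBall7, ‖ψ x‖ₑ
          ∂((surfaceMeasure 7 (sphereRadius (i + 15))).comap Subtype.val) := by
          refine Finset.sum_le_sum fun i hi => ?_
          have := Finset.mem_range.1 hi
          exact hterm (i + 15) (k + 15) (by omega) (by omega) ψ hψ hψ1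
      _ ≤ ∑' i : ℕ, ∫⁻ x : unitBall7, ‖ψ x‖ₑ
          ∂((surfaceMeasure 7 (sphereRadius (i + 15))).comap Subtype.val) := ENNReal.sum_le_tsum _
      _ ≤ ∑' n : ℕ, ∫⁻ x : unitBall7, ‖ψ x‖ₑ
          ∂((surfaceMeasure 7 (sphereRadius n)).comap Subtype.val) :=
          ENNReal.tsum_comp_le_tsum_of_injective (add_left_injective 15) _
      _ = ∫⁻ x : unitBall7, ‖ψ x‖ₑ ∂sphereSum := by
          rw [sphereSum_eq, lintegral_sum_measure]
      _ ≤ ENNReal.ofReal C := hle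
      _ ≤ _ := ENNReal.ofReal_le_ofReal (le_max_left _ _)
  have hsum := summable_of_sum_range_le (fun i => by positivity) hbound
  refine Real.not_summable_one_div_natCast ((summable_nat_add_iff 16).1 ?_)
  refine (hsum.mul_right (2 / τ.toReal)).congr fun i => ?_
  push_cast
  field_simp
  ring

end Energy

/-- If `ν = ν₁ - ν₂` with `ν₁, ν₂ ∈ S₀`, then `sphereSum ≤ ν₁` would inherit the energy estimate
of `ν₁`, which it does not satisfy. -/
theorem notMem_finiteEnergyDiff_of_sphereSum_eq [IsFiniteMeasure sphereSum] (f : unitBall7 → ℝ)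
    (ν : SignedMeasure unitBall7) (hf : Integrable f (lebesgueOn unitBall7))
    (h : sphereSum.toSignedMeasure = (lebesgueOn unitBall7).withDensityᵥ f + ν) :
    ν ∉ (classicalForm unitBall7 isOpen_unitBall7).finiteEnergyDiff := by
  rintro ⟨ν₁, ν₂, ⟨-, c, hc, hν₁⟩, -, hν⟩
  -- `A` is the union of the spheres, a Lebesgue null set that carries the sum.
  set A : Set unitBall7 := ⋃ n, Subtype.val ⁻¹' Metric.sphere 0 (sphereRadius n) with hA
  have hAm : MeasurableSet A := MeasurableSet.iUnion fun n =>
    measurable_subtype_coe Metric.isClosed_sphere.measurableSet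
  have hA0 : lebesgueOn unitBall7 A = 0 := by
    refine measure_iUnion_null fun n => ?_
    rw [lebesgueOn, comap_subtype_coe_apply isOpen_unitBall7.measurableSet]
    exact measure_mono_null (Set.image_preimage_subset _ _) (Measure.addHaar_sphere _ _ _)
  have hAc : sphereSum Aᶜ = 0 := by
    rw [sphereSum_apply hAm.compl, ENNReal.tsum_eq_zero]
    intro n
    refine measure_mono_null (t := (Metric.sphere 0 (sphereRadius n))ᶜ) ?_ ?_
    · rintro _ ⟨x, hx, rfl⟩ hx'
      exact hx (Set.mem_iUnion.2 ⟨n, hx'⟩)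
    · rw [surfaceMeasure_apply Metric.isClosed_sphere.measurableSet.compl]
      have : {θ : Metric.sphere (0 : EuclideanSpace ℝ (Fin 7)) 1 |
          sphereRadius n • (θ : EuclideanSpace ℝ (Fin 7)) ∈
            (Metric.sphere 0 (sphereRadius n))ᶜ} = ∅ := by
        ext θ
        simp [norm_smul, abs_of_pos (sphereRadius_pos n)]
      rw [this, measure_empty, mul_zero]
  have hle := le_of_toSignedMeasure_eq_withDensityᵥ_add hAm hA0 hAc hf h hν
  obtain ⟨K, hK⟩ := exists_test_inv_norm_sq_add_bound
  refine not_exists_energy_bound_sphereSum (c * K) fun ε hε => ?_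
  obtain ⟨ψ, hψ, hψ1, u, hu, huK⟩ := hK ε hε
  refine ⟨ψ, hψ, hψ1, (lintegral_mono' hle le_rfl).trans ((hν₁ u (fun x => ψ x) ⟨?_, hu.symm⟩).trans
    (ENNReal.ofReal_le_ofReal (by gcongr)))⟩
  exact L2Form.isQuasiContinuous_of_continuous _ (hψ.1.continuous.comp continuous_subtype_val)

theorem mainTheorem6 :
    -- `μ` is a bounded smooth measure
    (∃ _ : IsFiniteMeasure sphereSum,
      (classicalForm unitBall7 isOpen_unitBall7).IsSmooth sphereSum ∧
      sphereSum.toSignedMeasure ∈ (classicalForm unitBall7 isOpen_unitBall7).boundedSmooth ∧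
      -- for every decomposition `μ = f dx + ν`, the part `ν` is not in `S₀ - S₀`
      ∀ (f : unitBall7 → ℝ) (ν : SignedMeasure unitBall7), Integrable f (lebesgueOn unitBall7) →
        sphereSum.toSignedMeasure = (lebesgueOn unitBall7).withDensityᵥ f + ν →
        ν ∉ (classicalForm unitBall7 isOpen_unitBall7).finiteEnergyDiff) ∧
    -- hence the decomposition of `𝓜_{0,b}` fails with `(S₀ - S₀) ∩ 𝓜_b`
    (classicalForm unitBall7 isOpen_unitBall7).boundedSmooth ≠
      {μ | ∃ (f : unitBall7 → ℝ) (ν : SignedMeasure unitBall7), Integrable f (lebesgueOn unitBall7) ∧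
        ν ∈ (classicalForm unitBall7 isOpen_unitBall7).finiteEnergyDiff ∧
        μ = (lebesgueOn unitBall7).withDensityᵥ f + ν} := by
  have hfin : IsFiniteMeasure sphereSum := isFiniteMeasure_sphereSum
  have hmem : sphereSum.toSignedMeasure ∈
      (classicalForm unitBall7 isOpen_unitBall7).boundedSmooth := by
    change (classicalForm unitBall7 isOpen_unitBall7).IsSmooth _
    rw [totalVariation_toSignedMeasure]
    exact isSmooth_sphereSum
  refine ⟨⟨hfin, isSmooth_sphereSum, hmem, notMem_finiteEnergyDiff_of_sphereSum_eq⟩, fun heq => ?_⟩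
  rw [heq] at hmem
  obtain ⟨f, ν, hf, hν, h⟩ := hmem
  exact notMem_finiteEnergyDiff_of_sphereSum_eq f ν hf h hν
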